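/- \textbf{Setting.} Let $\mathcal S$ be a measurable space with a $\sigma$-finite measure $\lambda$, let $\Theta\subseteq\mathbb R^p$, and let $\mathcal M=\{M_\theta:\theta\in\Theta\}$ be a parametric family of probability measures with densities $m_\theta$ with respect to $\lambda$. For each $\theta\in\Theta$ let $K_{M_\theta}:\mathcal S\times\mathcal S\to\mathbb R$ be a bounded, measurable, symmetric, conditionally nonnegative definite kernel (that is, $\iint K_{M_\theta}\,d\sigma\,d\sigma\ge 0$ for all finite signed measures $\sigma$ with $\sigma(\mathcal S)=0$), possibly depending on $M_\theta$, and define the quadratic distance $$d_K(F,G)=\iint K_G(s,t)\,d(F-G)(s)\,d(F-G)(t).$$ Suppose that the true distribution is $F_\tau=M_{\theta_\tau}$ with $\theta_\tau\in\Theta$, and write $K=K_{F_\tau}$. If the kernel does depend on $\theta$, suppose that $K_{M_\theta}$ is uniformly bounded for $\theta$ near $\theta_\tau$ and that $K_{M_\theta}(s,t)\to K(s,t)$ as $\theta\to\theta_\tau$ for $F_\tau\otimes F_\tau$-almost all $(s,t)$. Let $\mathbf u(x)=\nabla_\theta\log m_\theta(x)|_{\theta=\theta_\tau}$ be the score, $\mathbb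 J=\int \mathbf u\mathbf u^T\,dM_{\theta_\tau}$ the information matrix, $P(x,y)=\mathbf u(x)^T\mathbb J^{-1}\mathbf u(y)$, and $$V(x,y)=\iint P(x,z)K(z,w)P(w,y)\,dM_{\theta_\tau}(z)\,dM_{\theta_\tau}(w).$$ Let $X_1,X_2,\dots$ be i.i.d. with law $F_\tau$, let $\hat F$ be the empirical distribution of $X_1,\dots,X_m$, and let $\hat\theta$ be the maximum likelihood estimator based on $X_1,\dots,X_m$ (a maximizer of $\theta\mapsto\prod_{i\le m} m_\theta(X_i)$ over $\Theta$, with probability tending to one as $m\to\infty$). Assume the following standard regularity conditions. \begin{itemize} \item[(a)] There is an open set $N$ with $\theta_\tau\in N\subseteq\Theta$ such that for $\lambda$-almost every $x$ the function $\theta\mapsto m_\theta(x)$ is twice continuously differentiable on $N$ and either vanishes nowhere or everywhere on $N$; and there are a $\lambda$-integrable $h$ and an $M_{\theta_\tau}$-integrable $H$ with $\sup_{\theta\in N}\|\nabla^2 m_\theta(x)\|\le h(x)$ for $\lambda$-almost every $x$ and $\sup_{\theta\in N}\|\nabla^2\log m_\theta(x)\|\le H(x)$ for $M_{\theta_\tau}$-almost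 every $x$. \item[(b)] $\mathbf u\in L^2(M_{\theta_\tau})$ and $\mathbb J$ is nonsingular. \item[(c)] (Identifiability, in Wald's form.) For every $\varepsilon>0$ there are $k\in\mathbb N$ and finitely many sets $U_1,\dots,U_r$ covering $\{\theta\in\Theta:|\theta-\theta_\tau|\ge\varepsilon\}$, and for each $j$ a function $g_j\in L^1(M_{\theta_\tau}^{\otimes k})$ with $\int g_j\,dM_{\theta_\tau}^{\otimes k}<0$, such that for $M_{\theta_\tau}^{\otimes k}$-almost all $(x_1,\dots,x_k)$ and all $\theta\in U_j\cap\Theta$, $\prod_{i\le k}m_\theta(x_i)\le e^{g_j(x_1,\dots,x_k)}\prod_{i\le k}m_{\theta_\tau}(x_i)$. \end{itemize} \textbf{Proposition.} One has $d_K(F_\tau,M_{\theta_\tau})=0$, and as $m\to\infty$ $$m\,d_K(F_\tau,M_{\hat\theta})-m\iint V(x,y)\,d\hat F(x)\,d\hat F(y)\longrightarrow 0\quad\text{in probability}.$$ It follows that the asymptotic mean of $m\,d_K(F_\tau,M_{\hat\theta})$ is $$\mathrm{trace}_{\theta_\tau}(V)=\int V(x,x)\,dM_{\theta_\tau}(x),$$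 where the integrand is integrable. That is, $m\,d_K(F_\tau,M_{\hat\theta})$ converges in distribution to a law on $\mathbb R$ with finite mean $\mathrm{trace}_{\theta_\tau}(V)$, and $E\big[m\iint V\,d\hat F\,d\hat F\big]=\mathrm{trace}_{\theta_\tau}(V)$ for every $m\ge1$. If moreover the sequence $m\,d_K(F_\tau,M_{\hat\theta})$ is uniformly integrable, then the parameter estimation cost $\mathrm{PEC}_{(m)}=E\big[d_K(F_\tau,M_{\hat\theta})-d_K(F_\tau,M_{\theta_\tau})\big]$ satisfies $m\,\mathrm{PEC}_{(m)}\to\mathrm{trace}_{\theta_\tau}(V)$. -/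

import Mathlib

open MeasureTheory ProbabilityTheory Filter Topology
open scoped Matrix ENNReal

namespace QuadRisk

noncomputable section

/-! Quadratic distances -/

/-- The double integral `∬ k(s,t) dμ(s) dν(t)`. -/
def biInt {S : Type*} [MeasurableSpace S] (k : S → S → ℝ) (μ ν : Measure S) : ℝ :=
  ∫ s, ∫ t, k s t ∂ν ∂μ

/-- `∬ k(s,t) d(μ - ν)(s) d(μ - ν)(t)` for a fixed kernel `k` and finite measures `μ`, `ν`,
expanded by bilinearity. -/
def quadForm {S : Type*} [MeasurableSpace S] (k : S → S → ℝ) (μ ν : Measure S) : ℝ :=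
  biInt k μ μ - biInt k μ ν - biInt k ν μ + biInt k ν ν

/-- A bounded, symmetric, (jointly measurable,) conditionally nonnegative definite kernel.
Conditional nonnegative definiteness is `∬ k dσ dσ ≥ 0` for all finite signed measures `σ` of total
mass zero; these are exactly the differences `μ - ν` of finite measures of equal mass. -/
structure IsCNNDKernel {S : Type*} [MeasurableSpace S] (k : S → S → ℝ) : Prop where
  measurable : Measurable (Function.uncurry k)
  bounded : ∃ C : ℝ, ∀ s t, |k s t| ≤ C
  symm : ∀ s t, k s t = k t s
  nonneg : ∀ (μ ν : Measure S) [IsFiniteMeasure μ] [IsFiniteMeasure ν],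
    μ Set.univ = ν Set.univ → 0 ≤ quadForm k μ ν

/-- The quadratic distance `d_K(F,G) = ∬ K_G(s,t) d(F - G)(s) d(F - G)(t)`; the kernel may depend
on the second argument `G`. -/
def quadDist {S : Type*} [MeasurableSpace S] (K : Measure S → S → S → ℝ) (F G : Measure S) : ℝ :=
  quadForm (K G) F G

/-- The functional trace `trace_G(k) = ∫ k(x,x) dG(x)`. -/
def kernelTrace {S : Type*} [MeasurableSpace S] (G : Measure S) (k : S → S → ℝ) : ℝ :=
  ∫ x, k x x ∂G

/-- `∬ k dF̂ dF̂`, where `F̂` is the empirical distribution of the sample `x`. -/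
def empiricalForm {S : Type*} (k : S → S → ℝ) {n : ℕ} (x : Fin n → S) : ℝ :=
  (∑ i, ∑ j, k (x i) (x j)) / (n : ℝ) ^ 2

/-! Parametric models -/

/-- The distribution `M_θ` with density `f θ` with respect to the dominating measure `lam`. -/
def model {S : Type*} [MeasurableSpace S] {p : ℕ} (lam : Measure S)
    (f : EuclideanSpace ℝ (Fin p) → S → ℝ) (θ : EuclideanSpace ℝ (Fin p)) : Measure S :=
  lam.withDensity (fun x => ENNReal.ofReal (f θ x))

/-- `f θ`, `θ ∈ Θ`, are probability densities with respect to `lam`. -/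
structure IsDensityFamily {S : Type*} [MeasurableSpace S] {p : ℕ} (lam : Measure S)
    (Θ : Set (EuclideanSpace ℝ (Fin p))) (f : EuclideanSpace ℝ (Fin p) → S → ℝ) : Prop where
  measurable : ∀ θ ∈ Θ, Measurable (f θ)
  nonneg : ∀ θ ∈ Θ, ∀ x, 0 ≤ f θ x
  isProbabilityMeasure : ∀ θ ∈ Θ, IsProbabilityMeasure (model lam f θ)

/-- The score `u(x) = ∇ log f(x; θ)`. -/
def score {S : Type*} {p : ℕ} (f : EuclideanSpace ℝ (Fin p) → S → ℝ)
    (θ : EuclideanSpace ℝ (Fin p)) (x : S) : EuclideanSpace ℝ (Fin p) :=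
  gradient (fun θ' => Real.log (f θ' x)) θ

/-- The information matrix `J = E_θ[u uᵀ]` of a single observation. -/
def fisherInfo {S : Type*} [MeasurableSpace S] {p : ℕ} (lam : Measure S)
    (f : EuclideanSpace ℝ (Fin p) → S → ℝ) (θ : EuclideanSpace ℝ (Fin p)) :
    Matrix (Fin p) (Fin p) ℝ :=
  Matrix.of fun i j => ∫ x, score f θ x i * score f θ x j ∂(model lam f θ)

/-- The score projection kernel `P(x,y) = u(x)ᵀ J⁻¹ u(y)`. -/
def projKernel {S : Type*} [MeasurableSpace S] {p : ℕ} (lam : Measure S)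
    (f : EuclideanSpace ℝ (Fin p) → S → ℝ) (θ : EuclideanSpace ℝ (Fin p)) (x y : S) : ℝ :=
  (score f θ x).ofLp ⬝ᵥ ((fisherInfo lam f θ)⁻¹ *ᵥ (score f θ y).ofLp)

/-- `V(x,y) = ∬ P(x,z) k(z,w) P(w,y) dM_θ(z) dM_θ(w)`. -/
def projectedKernel {S : Type*} [MeasurableSpace S] {p : ℕ} (lam : Measure S)
    (f : EuclideanSpace ℝ (Fin p) → S → ℝ) (θ : EuclideanSpace ℝ (Fin p)) (k : S → S → ℝ)
    (x y : S) : ℝ :=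
  ∫ z, ∫ w, projKernel lam f θ x z * k z w * projKernel lam f θ w y
    ∂(model lam f θ) ∂(model lam f θ)

/-- `t` is a maximum likelihood estimate of the parameter for the sample `x`: it maximizes the
likelihood over the parameter space `Θ`. -/
def IsMLE {S : Type*} {p : ℕ} (Θ : Set (EuclideanSpace ℝ (Fin p)))
    (f : EuclideanSpace ℝ (Fin p) → S → ℝ) {n : ℕ} (x : Fin n → S)
    (t : EuclideanSpace ℝ (Fin p)) : Prop :=
  t ∈ Θ ∧ ∀ θ ∈ Θ, ∏ i, f θ (x i) ≤ ∏ i, f t (x i)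

/-- Classical (Cramér type) regularity of the densities near the interior point `θ₀` of the
parameter space. -/
structure CramerRegularAt {S : Type*} [MeasurableSpace S] {p : ℕ} (lam : Measure S)
    (Θ : Set (EuclideanSpace ℝ (Fin p))) (f : EuclideanSpace ℝ (Fin p) → S → ℝ)
    (θ₀ : EuclideanSpace ℝ (Fin p)) : Prop where
  /-- On a neighbourhood of `θ₀` the densities have common support and are twice continuously
  differentiable in the parameter; the second derivatives of the density and of its logarithm have
  a dominating function that is integrable with respect to `lam` and to `M_θ₀` respectively. -/
  smooth : ∃ N : Set (EuclideanSpace ℝ (Fin p)), IsOpen N ∧ θ₀ ∈ N ∧ N ⊆ Θ ∧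
    (∀ᵐ x ∂lam, ∀ θ ∈ N, (f θ x = 0 ↔ f θ₀ x = 0)) ∧
    (∀ᵐ x ∂lam, ContDiffOn ℝ 2 (fun θ => f θ x) N) ∧
    (∃ h : S → ℝ, Integrable h lam ∧
      ∀ᵐ x ∂lam, ∀ θ ∈ N, ‖iteratedFDeriv ℝ 2 (fun θ' => f θ' x) θ‖ ≤ h x) ∧
    (∃ H : S → ℝ, Integrable H (model lam f θ₀) ∧
      ∀ᵐ x ∂(model lam f θ₀), ∀ θ ∈ N,
        ‖iteratedFDeriv ℝ 2 (fun θ' => Real.log (f θ' x)) θ‖ ≤ H x)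
  /-- The information matrix is finite ... -/
  score_memLp : MemLp (score f θ₀) 2 (model lam f θ₀)
  /-- ... and nonsingular. -/
  info_nonsingular : IsUnit (fisherInfo lam f θ₀).det

/-- Identifiability in the form used by Wald: away from `θ₀`, the parameter space is covered by
finitely many sets, on each of which the log likelihood ratio against `θ₀` of some fixed number `k`
of observations is bounded above, uniformly in `θ`, by a function with negative expectation
under `θ₀`. -/
def WaldSeparatedAt {S : Type*} [MeasurableSpace S] {p : ℕ} (lam : Measure S)
    (Θ : Set (EuclideanSpace ℝ (Fin p))) (f : EuclideanSpace ℝ (Fin p) → S → ℝ)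
    (θ₀ : EuclideanSpace ℝ (Fin p)) : Prop :=
  ∀ ε : ℝ, 0 < ε → ∃ (k r : ℕ) (U : Fin r → Set (EuclideanSpace ℝ (Fin p))),
    (∀ θ ∈ Θ, ε ≤ dist θ θ₀ → ∃ j, θ ∈ U j) ∧
    ∀ j, ∃ g : (Fin k → S) → ℝ,
      Integrable g (Measure.pi fun _ => model lam f θ₀) ∧
      ∫ x, g x ∂(Measure.pi fun _ => model lam f θ₀) < 0 ∧
      ∀ᵐ x ∂(Measure.pi fun _ => model lam f θ₀), ∀ θ ∈ Θ ∩ U j,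
        ∏ i, f θ (x i) ≤ Real.exp (g x) * ∏ i, f θ₀ (x i)

/-! Asymptotic mean -/

/-- `a` is the asymptotic mean of `Y n`: `Y n` converges in distribution to a law on `ℝ` with a
finite mean, and that mean is `a`. -/
def HasAsymptoticMean {Ω : Type*} [MeasurableSpace Ω] (P : Measure Ω) [IsProbabilityMeasure P]
    (Y : ℕ → Ω → ℝ) (a : ℝ) : Prop :=
  ∃ (Q : Measure ℝ) (_ : IsProbabilityMeasure Q),
    TendstoInDistribution Y atTop (fun t : ℝ => t) (fun _ => P) Q ∧
    Integrable (fun t : ℝ => t) Q ∧ ∫ t, t ∂Q = a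

end

end QuadRisk

open QuadRisk

/-! Write F = M_{θ_τ}, L_θ for the density of M_θ with respect to F, and v = θ - θ_τ. By bilinearity
d_K(F, M_θ) = ∬ K_θ (L_θ - 1)(L_θ - 1) dF dF (`quadForm_withDensity`). Since L_θ - 1 = ⟨u, v⟩ + O(h
|v|²) with h integrable, and K_θ → K boundedly, this equals a(v, v) + o(|v|²), where a(v, w) = ∬ K
⟨u, v⟩⟨u, w⟩ dF dF (`LikelihoodExpansion.quadForm_isLittleO`).

The estimator is consistent by Wald's argument (`withHighProb_prod_lt`). On a fixed ball around θ_τ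
the mean log likelihood ratio is, with high probability, ⟨ū, v⟩ - ½ vᵀJv up to η|v|², where ū is the
mean score (`LikelihoodExpansion.withHighProb_loglik`). A maximizer of such a criterion is close to
the maximizer d = J⁻¹ū of the quadratic, with an error small relative to |d|
(`norm_sub_sq_le_of_approx_quadratic`). So for each ε, with high probability, |d_K(F, M_θ̂) - a(d,
d)| ≤ ε|d|² (`LikelihoodExpansion.withHighProb_discrepancy`). As m E|d|² does not depend on m ≥ 1,
multiplying by m and applying Markov's inequality gives convergence to zero in probability
(`tendstoInMeasure_zero_of_le_mul`).

Finally V(x, y) = a(J⁻¹u(x), J⁻¹u(y)), so a(d, d) is exactly ∬ V dF̂ dF̂. Independence and centering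
of the scores give its mean. The central limit theorem gives the limit law of m a(d, d): a quadratic
form in a Gaussian vector with the second moments of u, hence with the same mean, trace(V). Uniform
integrability carries the limit over to the expectations. -/

namespace QuadRisk

/-! ### Taylor expansions of order two -/

section Taylor

variable {E : Type*} [NormedAddCommGroup E] [NormedSpace ℝ E]

theorem norm_fderiv_fderiv_eq (g : E → ℝ) (x : E) :
    ‖fderiv ℝ (fderiv ℝ g) x‖ = ‖iteratedFDeriv ℝ 2 g x‖ := by
  rw [← norm_iteratedFDeriv_fderiv, ← norm_iteratedFDeriv_fderiv, norm_iteratedFDeriv_zero]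

/-- First order Taylor expansion with a quadratic remainder bound. -/
theorem abs_sub_fderiv_le_of_iteratedFDeriv_le {g : E → ℝ} {x₀ : E} {r C : ℝ}
    (hg : ContDiffOn ℝ 2 g (Metric.ball x₀ r))
    (hC : ∀ x ∈ Metric.ball x₀ r, ‖iteratedFDeriv ℝ 2 g x‖ ≤ C) {x : E}
    (hx : x ∈ Metric.ball x₀ r) :
    |g x - g x₀ - fderiv ℝ g x₀ (x - x₀)| ≤ C * ‖x - x₀‖ ^ 2 := by
  have hr : 0 < r := Metric.pos_of_mem_ball hx
  have h0 : x₀ ∈ Metric.ball x₀ r := Metric.mem_ball_self hr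
  have hat : ∀ y ∈ Metric.ball x₀ r, ContDiffAt ℝ 2 g y := fun y hy =>
    hg.contDiffAt (Metric.isOpen_ball.mem_nhds hy)
  have hd2 : ∀ y ∈ Metric.ball x₀ r, DifferentiableAt ℝ (fderiv ℝ g) y := fun y hy =>
    ((hat y hy).fderiv_right (m := 1) (by norm_num)).differentiableAt (by norm_num)
  have hlip : ∀ y ∈ Metric.ball x₀ r, ‖fderiv ℝ g y - fderiv ℝ g x₀‖ ≤ C * ‖y - x₀‖ :=
    fun y hy => (convex_ball x₀ r).norm_image_sub_le_of_norm_fderiv_le hd2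
      (fun z hz => (norm_fderiv_fderiv_eq g z).trans_le (hC z hz)) h0 hy
  have hC0 : 0 ≤ C := (norm_nonneg _).trans (hC x₀ h0)
  -- On this convex set the derivative stays within C ‖x - x₀‖ of its value at x₀, so the mean value
  -- inequality applies. It gives C instead of the sharp C / 2, which is enough.
  set s := Metric.ball x₀ r ∩ Metric.closedBall x₀ ‖x - x₀‖ with hs
  have hsc : Convex ℝ s := (convex_ball x₀ r).inter (convex_closedBall _ _)
  have hxs : x ∈ s := ⟨hx, by simp [dist_eq_norm]⟩
  have h0s : x₀ ∈ s := ⟨h0, by simp⟩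
  have key := hsc.norm_image_sub_le_of_norm_hasFDerivWithin_le'
    (f := g) (f' := fderiv ℝ g) (φ := fderiv ℝ g x₀) (C := C * ‖x - x₀‖)
    (fun y hy => (((hat y hy.1).differentiableAt (by norm_num)).hasFDerivAt).hasFDerivWithinAt)
    (fun y hy => (hlip y hy.1).trans (by
      have : ‖y - x₀‖ ≤ ‖x - x₀‖ := by simpa [dist_eq_norm] using hy.2
      gcongr)) h0s hxs
  rw [Real.norm_eq_abs] at key
  calc _ ≤ _ := key
    _ = _ := by ring

/-- Second order Taylor expansion at a point. -/
theorem taylor_two_isLittleO {g : E → ℝ} {x₀ : E} (hg : ContDiffAt ℝ 2 g x₀) :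
    (fun x => g x - g x₀ - fderiv ℝ g x₀ (x - x₀)
      - (1 / 2) * fderiv ℝ (fderiv ℝ g) x₀ (x - x₀) (x - x₀))
      =o[𝓝 x₀] fun x => ‖x - x₀‖ ^ 2 := by
  set D := fderiv ℝ (fderiv ℝ g) x₀ with hD
  have hd2 : HasFDerivAt (fderiv ℝ g) D x₀ :=
    ((hg.fderiv_right (m := 1) (by norm_num)).differentiableAt (by norm_num)).hasFDerivAt
  have hsymm : ∀ v w, D v w = D w v := fun v w => by
    have := hg.isSymmSndFDerivAt (by simp)
    exact this v w
  have hdiff : ∀ᶠ y in 𝓝 x₀, DifferentiableAt ℝ g y :=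
    (hg.eventually (by simp)).mono fun y hy => hy.differentiableAt (by norm_num)
  rw [Asymptotics.isLittleO_iff]
  intro c hc
  have ho := (hasFDerivAt_iff_isLittleO.1 hd2)
  rw [Asymptotics.isLittleO_iff] at ho
  obtain ⟨r, hr, hball⟩ := Metric.eventually_nhds_iff_ball.1 ((ho hc).and hdiff)
  filter_upwards [Metric.ball_mem_nhds x₀ hr] with x hx
  set s := Metric.ball x₀ r ∩ Metric.closedBall x₀ ‖x - x₀‖ with hs
  have hsc : Convex ℝ s := (convex_ball x₀ r).inter (convex_closedBall _ _)
  have hxs : x ∈ s := ⟨hx, by simp [dist_eq_norm]⟩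
  have h0s : x₀ ∈ s := ⟨Metric.mem_ball_self hr, by simp⟩
  -- Symmetry of D makes 2 D (y - x₀) the derivative of the quadratic term, so the derivative of the
  -- second order remainder of g is the first order remainder of `fderiv ℝ g`.
  have hder : ∀ y ∈ s, HasFDerivWithinAt
      (fun x => g x - fderiv ℝ g x₀ (x - x₀) - (1 / 2) * D (x - x₀) (x - x₀))
      (fderiv ℝ g y - fderiv ℝ g x₀ - D (y - x₀)) s y := by
    intro y hy
    have h1 : HasFDerivAt g (fderiv ℝ g y) y := (hball y hy.1).2.hasFDerivAt
    have h2 : HasFDerivAt (fun x => x - x₀) (ContinuousLinearMap.id ℝ E) y :=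
      (hasFDerivAt_id y).sub_const x₀
    have h3 : HasFDerivAt (fun x => fderiv ℝ g x₀ (x - x₀)) (fderiv ℝ g x₀) y := by
      have := (fderiv ℝ g x₀).hasFDerivAt.comp y h2
      rwa [ContinuousLinearMap.comp_id] at this
    have h4 : HasFDerivAt (fun x => D (x - x₀) (x - x₀)) ((2 : ℝ) • D (y - x₀)) y := by
      have := (D.hasFDerivAt.comp y h2).clm_apply h2
      refine this.congr_fderiv ?_
      ext v
      simp [hsymm v, two_mul]
    have h5 := (h1.sub h3).sub (h4.const_mul (1 / 2))
    refine (h5.congr_fderiv ?_).hasFDerivWithinAt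
    ext v
    simp
  have key := hsc.norm_image_sub_le_of_norm_hasFDerivWithin_le hder
    (C := c * ‖x - x₀‖) (fun y hy => ((hball y hy.1).1).trans (by
      have : ‖y - x₀‖ ≤ ‖x - x₀‖ := by simpa [dist_eq_norm] using hy.2
      gcongr)) h0s hxs
  rw [Real.norm_of_nonneg (sq_nonneg ‖x - x₀‖)]
  calc _ = _ := by congr 1; simp; ring
    _ ≤ _ := key
    _ = _ := by ring

/-- Second order expansion of the logarithm of a function with a given second order expansion. -/
theorem log_isLittleO_of_isLittleO {g : E → ℝ} {x₀ : E} {ℓ : E →L[ℝ] ℝ} {D : E →L[ℝ] E →L[ℝ] ℝ}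
    (h : (fun x => g x - 1 - ℓ (x - x₀) - (1 / 2) * D (x - x₀) (x - x₀))
      =o[𝓝 x₀] fun x => ‖x - x₀‖ ^ 2) :
    (fun x => Real.log (g x) - ℓ (x - x₀)
      - (1 / 2) * (D (x - x₀) (x - x₀) - ℓ (x - x₀) ^ 2))
      =o[𝓝 x₀] fun x => ‖x - x₀‖ ^ 2 := by
  have hsub : Tendsto (fun x => x - x₀) (𝓝 x₀) (𝓝 0) := by
    have : Continuous fun x => x - x₀ := by fun_prop
    simpa using this.tendsto x₀
  have hl : (fun x => ℓ (x - x₀)) =O[𝓝 x₀] fun x => ‖x - x₀‖ :=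
    Asymptotics.IsBigO.of_bound ‖ℓ‖ (Eventually.of_forall fun x => by
      simpa using ℓ.le_opNorm (x - x₀))
  have hD : (fun x => (1 / 2) * D (x - x₀) (x - x₀)) =O[𝓝 x₀] fun x => ‖x - x₀‖ ^ 2 := by
    refine Asymptotics.IsBigO.const_mul_left ?_ _
    refine Asymptotics.IsBigO.of_bound ‖D‖ (Eventually.of_forall fun x => ?_)
    have := D.le_opNorm₂ (x - x₀) (x - x₀)
    simpa [pow_two, mul_assoc] using this
  have hsq : (fun x => ‖x - x₀‖ ^ 2) =o[𝓝 x₀] fun x => ‖x - x₀‖ := by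
    have h1 : (fun x => ‖x - x₀‖) =o[𝓝 x₀] fun _ => (1 : ℝ) := by
      rw [Asymptotics.isLittleO_one_iff]
      simpa using hsub.norm
    simpa [pow_two] using h1.mul_isBigO (Asymptotics.isBigO_refl (fun x => ‖x - x₀‖) (𝓝 x₀))
  -- `y = g - 1` and its linear part
  have hy2 : (fun x => g x - 1 - ℓ (x - x₀)) =O[𝓝 x₀] fun x => ‖x - x₀‖ ^ 2 := by
    have := h.isBigO.add hD
    refine this.congr_left fun x => ?_
    ring
  have hy1 : (fun x => g x - 1) =O[𝓝 x₀] fun x => ‖x - x₀‖ := by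
    have := (hy2.trans hsq.isBigO).add hl
    refine this.congr_left fun x => ?_
    ring
  have hy0 : Tendsto (fun x => g x - 1) (𝓝 x₀) (𝓝 0) :=
    hy1.trans_tendsto (by simpa using hsub.norm)
  -- This is `taylor_two_isLittleO` on ℝ, once the derivatives 1 and -1 of log (1 + y) at 0 are
  -- computed.
  have hlog : (fun y : ℝ => Real.log (1 + y) - y + y ^ 2 / 2) =o[𝓝 0] fun y => y ^ 2 := by
    have hc : ContDiffAt ℝ 2 (fun y : ℝ => Real.log (1 + y)) 0 :=
      (by fun_prop : ContDiffAt ℝ 2 (fun y : ℝ => 1 + y) 0).log (by norm_num)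
    have hd : ∀ᶠ y : ℝ in 𝓝 0, HasDerivAt (fun y : ℝ => Real.log (1 + y)) (1 + y)⁻¹ y := by
      filter_upwards [eventually_gt_nhds (show (-1 : ℝ) < 0 by norm_num)] with y hy
      have := ((hasDerivAt_id y).const_add 1).log (by simp; linarith)
      simpa using this
    have hf1 : fderiv ℝ (fun y : ℝ => Real.log (1 + y)) =ᶠ[𝓝 0]
        fun y => ContinuousLinearMap.toSpanSingleton ℝ (1 + y)⁻¹ := by
      filter_upwards [hd] with y hy
      exact hy.hasFDerivAt.fderiv
    have hf2 : HasDerivAt (fun y : ℝ => (1 + y)⁻¹) (-1) 0 := by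
      have := ((hasDerivAt_id (0 : ℝ)).const_add 1).fun_inv (by norm_num)
      simpa using this
    have h2 := taylor_two_isLittleO hc
    have hf3 : HasFDerivAt (fun y : ℝ => ContinuousLinearMap.toSpanSingleton ℝ (1 + y)⁻¹)
        ((ContinuousLinearMap.toSpanSingletonCLE (𝕜 := ℝ) (E := ℝ) :
          ℝ →L[ℝ] (ℝ →L[ℝ] ℝ)).comp (ContinuousLinearMap.toSpanSingleton ℝ (-1 : ℝ))) 0 :=
      (ContinuousLinearMap.hasFDerivAt
        (ContinuousLinearMap.toSpanSingletonCLE (𝕜 := ℝ) (E := ℝ) :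
          ℝ →L[ℝ] (ℝ →L[ℝ] ℝ))).comp 0 hf2.hasFDerivAt
    rw [hf1.fderiv_eq, hf3.fderiv, hf1.self_of_nhds] at h2
    refine (h2.congr_left fun y => ?_).congr_right fun y => ?_
    · simp; ring
    · simp
  have h1 : (fun x => Real.log (g x) - (g x - 1) + (g x - 1) ^ 2 / 2)
      =o[𝓝 x₀] fun x => ‖x - x₀‖ ^ 2 := by
    have := (hlog.comp_tendsto hy0).trans_isBigO (hy1.pow 2)
    refine this.congr_left fun x => ?_
    simp
  -- The difference of squares factors into o(‖x - x₀‖) times O(‖x - x₀‖).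
  have h2 : (fun x => (g x - 1) ^ 2 - ℓ (x - x₀) ^ 2) =o[𝓝 x₀] fun x => ‖x - x₀‖ ^ 2 := by
    have := (hy2.trans_isLittleO hsq).mul_isBigO (hy1.add hl)
    refine (this.congr_left fun x => ?_).congr_right fun x => ?_
    · ring
    · ring
  refine ((h1.add h).sub (h2.const_mul_left (1 / 2))).congr_left fun x => ?_
  ring

end Taylor

/-! ### Likelihood ratios and their expansion -/

section Expansion

variable {S : Type*} [MeasurableSpace S] {p : ℕ}

/-- Likelihood ratios `L θ` against `θ₀` of a model that is dominated near `θ₀` by the probability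
measure `F`, with score `u`, second derivative `W` and quadratic envelopes `h` and `H` for the
remainders of the ratio and of its logarithm on the ball of radius `ρ`. -/
structure LikelihoodExpansion {E : Type*} [NormedAddCommGroup E] [InnerProductSpace ℝ E]
    (F : Measure S) (θ₀ : E) (L : E → S → ℝ) (u : S → E) (W : S → E →L[ℝ] E →L[ℝ] ℝ)
    (ρ : ℝ) (h H : S → ℝ) : Prop where
  radius_pos : 0 < ρ
  measurable : ∀ θ ∈ Metric.ball θ₀ ρ, Measurable (L θ)
  pos : ∀ᵐ x ∂F, ∀ θ ∈ Metric.ball θ₀ ρ, 0 < L θ x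
  continuousOn : ∀ᵐ x ∂F, ContinuousOn (fun θ => L θ x) (Metric.ball θ₀ ρ)
  integrable_h : Integrable h F
  integrable_H : Integrable H F
  abs_sub_le : ∀ᵐ x ∂F, ∀ θ ∈ Metric.ball θ₀ ρ,
    |L θ x - 1 - inner ℝ (u x) (θ - θ₀)| ≤ h x * ‖θ - θ₀‖ ^ 2
  abs_log_sub_le : ∀ᵐ x ∂F, ∀ θ ∈ Metric.ball θ₀ ρ,
    |Real.log (L θ x) - inner ℝ (u x) (θ - θ₀)| ≤ H x * ‖θ - θ₀‖ ^ 2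
  abs_apply_le : ∀ᵐ x ∂F, ∀ v w, |W x v w| ≤ h x * ‖v‖ * ‖w‖
  symm : ∀ᵐ x ∂F, ∀ v w, W x v w = W x w v
  isLittleO : ∀ᵐ x ∂F, (fun θ => L θ x - 1 - inner ℝ (u x) (θ - θ₀)
    - (1 / 2) * W x (θ - θ₀) (θ - θ₀)) =o[𝓝 θ₀] fun θ => ‖θ - θ₀‖ ^ 2
  lintegral_eq_one : ∀ θ ∈ Metric.ball θ₀ ρ, ∫⁻ x, ENNReal.ofReal (L θ x) ∂F = 1
  memLp : MemLp u 2 F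

theorem ae_pos_of_model (lam : Measure S) (f : EuclideanSpace ℝ (Fin p) → S → ℝ)
    (θ : EuclideanSpace ℝ (Fin p)) (hm : Measurable (f θ)) :
    ∀ᵐ x ∂(model lam f θ), 0 < f θ x := by
  rw [model, ae_withDensity_iff (by fun_prop)]
  filter_upwards with x hx
  by_contra hcon
  exact hx (ENNReal.ofReal_eq_zero.2 (not_lt.1 hcon))

theorem model_eq_withDensity_ratio {lam : Measure S}
    {f : EuclideanSpace ℝ (Fin p) → S → ℝ} {θ₀ θ : EuclideanSpace ℝ (Fin p)}
    (hm₀ : Measurable (f θ₀)) (hm : Measurable (f θ)) (hnn : ∀ x, 0 ≤ f θ₀ x)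
    (hsupp : ∀ᵐ x ∂lam, f θ₀ x = 0 → f θ x = 0) :
    model lam f θ = (model lam f θ₀).withDensity
      (fun x => ENNReal.ofReal (f θ x / f θ₀ x)) := by
  rw [model, model, ← withDensity_mul _ (by fun_prop) (by fun_prop)]
  refine withDensity_congr_ae ?_
  filter_upwards [hsupp] with x hx
  simp only [Pi.mul_apply]
  rw [← ENNReal.ofReal_mul (hnn x)]
  rcases (hnn x).eq_or_lt with h0 | h0
  · simp [← h0, hx h0.symm]
  · rw [mul_div_cancel₀ _ h0.ne']

theorem inner_score {S : Type*} (f : EuclideanSpace ℝ (Fin p) → S → ℝ)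
    (θ : EuclideanSpace ℝ (Fin p)) (x : S) (v : EuclideanSpace ℝ (Fin p)) :
    inner ℝ (score f θ x) v = fderiv ℝ (fun θ' => Real.log (f θ' x)) θ v := by
  rw [score, gradient, InnerProductSpace.toDual_symm_apply]

/-- Dividing by f_{θ₀} turns the expansion of the densities under λ into one of the ratios under
M_{θ₀}: W is the second derivative of the density over the density, and the envelope h becomes h /
f_{θ₀}. -/
theorem CramerRegularAt.exists_expansion {lam : Measure S}
    {Θ : Set (EuclideanSpace ℝ (Fin p))} {f : EuclideanSpace ℝ (Fin p) → S → ℝ}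
    {θ₀ : EuclideanSpace ℝ (Fin p)}
    (hf : IsDensityFamily lam Θ f) (hreg : CramerRegularAt lam Θ f θ₀) :
    ∃ W ρ h H, LikelihoodExpansion (model lam f θ₀) θ₀ (fun θ x => f θ x / f θ₀ x)
      (score f θ₀) W ρ h H ∧ Metric.ball θ₀ ρ ⊆ Θ ∧
      ∀ θ ∈ Metric.ball θ₀ ρ, model lam f θ = (model lam f θ₀).withDensity
        (fun x => ENNReal.ofReal (f θ x / f θ₀ x)) := by
  obtain ⟨N, hNo, h0N, hNΘ, hsupp, hcd, ⟨h, hint, hh⟩, ⟨H, Hint, HH⟩⟩ := hreg.smooth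
  obtain ⟨ρ, hρ, hball⟩ := Metric.isOpen_iff.1 hNo θ₀ h0N
  set F := model lam f θ₀ with hF
  have hac : ∀ {q : S → Prop}, (∀ᵐ x ∂lam, q x) → ∀ᵐ x ∂F, q x := fun hq =>
    (withDensity_absolutelyContinuous lam _).ae_le hq
  have h0Θ : θ₀ ∈ Θ := hNΘ h0N
  have hm₀ := hf.measurable θ₀ h0Θ
  have hpos₀ := ae_pos_of_model lam f θ₀ hm₀
  have hpos : ∀ᵐ x ∂F, ∀ θ ∈ N, 0 < f θ x := by
    filter_upwards [hpos₀, hac hsupp] with x hx hs θ hθ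
    exact lt_of_le_of_ne (hf.nonneg θ (hNΘ hθ) x) fun h => hx.ne' ((hs θ hθ).1 h.symm)
  have hmodel : ∀ θ ∈ Metric.ball θ₀ ρ, model lam f θ = F.withDensity
        (fun x => ENNReal.ofReal (f θ x / f θ₀ x)) := fun θ hθ =>
    model_eq_withDensity_ratio hm₀ (hf.measurable θ (hNΘ (hball hθ))) (hf.nonneg θ₀ h0Θ)
      (hsupp.mono fun x hx => (hx θ (hball hθ)).2)
  have hcdb : ∀ᵐ x ∂F, ContDiffOn ℝ 2 (fun θ => f θ x) (Metric.ball θ₀ ρ) :=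
    (hac hcd).mono fun x hx => hx.mono hball
  have hat : ∀ᵐ x ∂F, ContDiffAt ℝ 2 (fun θ => f θ x) θ₀ :=
    hcdb.mono fun x hx => hx.contDiffAt (Metric.ball_mem_nhds θ₀ hρ)
  have hsc : ∀ᵐ x ∂F, ∀ v, inner ℝ (score f θ₀ x) v
      = fderiv ℝ (fun θ => f θ x) θ₀ v / f θ₀ x := by
    filter_upwards [hpos₀, hat] with x hx hc v
    rw [inner_score, fderiv.log (hc.differentiableAt (by norm_num)) hx.ne']
    simp [div_eq_inv_mul]
  refine ⟨fun x => (f θ₀ x)⁻¹ • fderiv ℝ (fderiv ℝ fun θ => f θ x) θ₀, ρ, fun x => h x / f θ₀ x, H,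
    ⟨hρ, ?_, ?_, ?_, ?_, Hint, ?_, ?_, ?_, ?_, ?_, ?_, hreg.score_memLp⟩, hball.trans hNΘ, hmodel⟩
  · intro θ hθ
    exact (hf.measurable θ (hNΘ (hball hθ))).div hm₀
  · filter_upwards [hpos] with x hx θ hθ
    exact div_pos (hx θ (hball hθ)) (hx θ₀ h0N)
  · filter_upwards [hcdb] with x hx
    exact hx.continuousOn.div_const _
  · rw [hF, model, integrable_withDensity_iff (by fun_prop) (by simp)]
    -- The density of F cancels the denominator where it is positive; elsewhere both sides are 0.
    have : (fun x => h x / f θ₀ x * (ENNReal.ofReal (f θ₀ x)).toReal)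
        = {x | 0 < f θ₀ x}.indicator h := by
      ext x
      by_cases hx : 0 < f θ₀ x
      · rw [Set.indicator_of_mem (by exact hx), ENNReal.toReal_ofReal hx.le,
          div_mul_cancel₀ _ hx.ne']
      · rw [Set.indicator_of_notMem (by exact hx)]
        simp [ENNReal.ofReal_eq_zero.2 (not_lt.1 hx)]
    rw [this]
    exact hint.indicator (measurableSet_lt measurable_const hm₀)
  · filter_upwards [hpos₀, hcdb, hac hh, hsc] with x hx hc hb hs θ hθ
    have := abs_sub_fderiv_le_of_iteratedFDeriv_le hc (fun θ hθ => hb θ (hball hθ)) hθ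
    rw [hs]
    have e : f θ x / f θ₀ x - 1 - fderiv ℝ (fun θ => f θ x) θ₀ (θ - θ₀) / f θ₀ x
        = (f θ x - f θ₀ x - fderiv ℝ (fun θ => f θ x) θ₀ (θ - θ₀)) / f θ₀ x := by
      field_simp
    rw [e, abs_div, abs_of_pos hx, div_mul_eq_mul_div]
    gcongr
  · filter_upwards [hpos, hcdb, HH] with x hx hc hb θ hθ
    have hcl : ContDiffOn ℝ 2 (fun θ => Real.log (f θ x)) (Metric.ball θ₀ ρ) :=
      hc.log fun θ hθ => (hx θ (hball hθ)).ne'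
    have := abs_sub_fderiv_le_of_iteratedFDeriv_le hcl (fun θ hθ => hb θ (hball hθ)) hθ
    rw [Real.log_div (hx θ (hball hθ)).ne' (hx θ₀ h0N).ne', inner_score]
    exact this
  · filter_upwards [hpos₀, hac hh] with x hx hb v w
    have h1 := (fderiv ℝ (fderiv ℝ fun θ => f θ x) θ₀).le_opNorm₂ v w
    rw [norm_fderiv_fderiv_eq, Real.norm_eq_abs] at h1
    have h2 := hb θ₀ h0N
    simp only [smul_apply, smul_eq_mul]
    rw [abs_mul, abs_inv, abs_of_pos hx, ← div_eq_inv_mul]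
    calc _ ≤ h x * ‖v‖ * ‖w‖ / f θ₀ x := by
          gcongr
          exact h1.trans (by gcongr)
      _ = _ := by ring
  · filter_upwards [hat] with x hx v w
    have := hx.isSymmSndFDerivAt (by simp)
    simp [this v w]
  · filter_upwards [hpos₀, hat, hsc] with x hx hc hs
    refine ((taylor_two_isLittleO hc).const_mul_left (f θ₀ x)⁻¹).congr_left fun θ => ?_
    rw [hs]
    simp only [smul_apply, smul_eq_mul]
    field_simp
  · intro θ hθ
    have := (hf.isProbabilityMeasure θ (hNΘ (hball hθ))).measure_univ
    rwa [hmodel θ hθ, withDensity_apply _ MeasurableSet.univ, setLIntegral_univ] at this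

end Expansion

/-! ### Mean zero of the score and of the second derivative -/

section ScoreMoments

variable {S : Type*} [MeasurableSpace S] {E : Type*} [NormedAddCommGroup E]
  [InnerProductSpace ℝ E] {F : Measure S} [IsProbabilityMeasure F] {θ₀ : E} {L : E → S → ℝ}
  {u : S → E}
  {W : S → E →L[ℝ] E →L[ℝ] ℝ} {ρ : ℝ} {h H : S → ℝ}

namespace LikelihoodExpansion

omit [IsProbabilityMeasure F] in
theorem integrable_ratio (hE : LikelihoodExpansion F θ₀ L u W ρ h H) {θ : E}
    (hθ : θ ∈ Metric.ball θ₀ ρ) : Integrable (L θ) F := by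
  refine ⟨(hE.measurable θ hθ).aestronglyMeasurable, ?_⟩
  rw [hasFiniteIntegral_iff_ofReal (hE.pos.mono fun x hx => (hx θ hθ).le),
    hE.lintegral_eq_one θ hθ]
  exact ENNReal.one_lt_top

omit [IsProbabilityMeasure F] in
theorem integral_ratio (hE : LikelihoodExpansion F θ₀ L u W ρ h H) {θ : E}
    (hθ : θ ∈ Metric.ball θ₀ ρ) : ∫ x, L θ x ∂F = 1 := by
  rw [integral_eq_lintegral_of_nonneg_ae (hE.pos.mono fun x hx => (hx θ hθ).le)
    (hE.measurable θ hθ).aestronglyMeasurable, hE.lintegral_eq_one θ hθ]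
  simp

theorem integrable_score (hE : LikelihoodExpansion F θ₀ L u W ρ h H) : Integrable u F :=
  hE.memLp.integrable (by norm_num)

theorem integrable_inner (hE : LikelihoodExpansion F θ₀ L u W ρ h H) (v : E) :
    Integrable (fun x => inner ℝ (u x) v) F :=
  hE.integrable_score.inner_const v

theorem tendsto_add_inv_smul (θ₀ v : E) :
    Tendsto (fun n : ℕ => θ₀ + ((n : ℝ) + 1)⁻¹ • v) atTop (𝓝 θ₀) := by
  have := (tendsto_one_div_add_atTop_nhds_zero_nat (𝕜 := ℝ)).smul_const v
  simpa using this.const_add θ₀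

omit [IsProbabilityMeasure F] in
theorem eventually_mem_ball (hE : LikelihoodExpansion F θ₀ L u W ρ h H) (v : E) :
    ∀ᶠ n : ℕ in atTop, θ₀ + ((n : ℝ) + 1)⁻¹ • v ∈ Metric.ball θ₀ ρ :=
  (tendsto_add_inv_smul θ₀ v).eventually (Metric.ball_mem_nhds θ₀ hE.radius_pos)

theorem integral_remainder (hE : LikelihoodExpansion F θ₀ L u W ρ h H) {θ : E}
    (hθ : θ ∈ Metric.ball θ₀ ρ) :
    ∫ x, (L θ x - 1 - inner ℝ (u x) (θ - θ₀)) ∂F = - ∫ x, inner ℝ (u x) (θ - θ₀) ∂F := by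
  rw [integral_sub ((hE.integrable_ratio hθ).sub' (integrable_const _)) (hE.integrable_inner _),
    integral_sub (hE.integrable_ratio hθ) (integrable_const _), hE.integral_ratio hθ]
  simp

/-- The score has mean zero. -/
theorem integral_inner_score (hE : LikelihoodExpansion F θ₀ L u W ρ h H) (v : E) :
    ∫ x, inner ℝ (u x) v ∂F = 0 := by
  set c := ∫ x, inner ℝ (u x) v ∂F with hc
  -- Along θ₀ + v/(n+1) the ratio keeps mean 1, so c/(n+1) is minus the mean of the remainder, which
  -- is O((n+1)⁻²).
  have hle : ∀ᶠ n : ℕ in atTop, |c| ≤ ((n : ℝ) + 1)⁻¹ * ((∫ x, h x ∂F) * ‖v‖ ^ 2) := by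
    filter_upwards [hE.eventually_mem_ball v] with n hn
    have hpos : (0 : ℝ) < (n : ℝ) + 1 := by positivity
    have h1 := hE.integral_remainder hn
    have h2 : ‖∫ x, (L (θ₀ + ((n : ℝ) + 1)⁻¹ • v) x - 1
        - inner ℝ (u x) (θ₀ + ((n : ℝ) + 1)⁻¹ • v - θ₀)) ∂F‖
        ≤ ∫ x, h x * ‖θ₀ + ((n : ℝ) + 1)⁻¹ • v - θ₀‖ ^ 2 ∂F :=
      norm_integral_le_of_norm_le (hE.integrable_h.mul_const _)
        (hE.abs_sub_le.mono fun x hx => hx _ hn)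
    rw [h1, integral_mul_const, Real.norm_eq_abs, abs_neg] at h2
    simp only [add_sub_cancel_left, inner_smul_right, integral_const_mul, norm_smul,
      Real.norm_eq_abs, abs_mul] at h2
    rw [abs_of_pos (inv_pos.2 hpos), ← hc] at h2
    have h3 : ((n : ℝ) + 1)⁻¹ * |c|
        ≤ ((n : ℝ) + 1)⁻¹ * (((n : ℝ) + 1)⁻¹ * ((∫ x, h x ∂F) * ‖v‖ ^ 2)) := by
      calc _ ≤ _ := h2
        _ = _ := by ring
    exact le_of_mul_le_mul_left h3 (inv_pos.2 hpos)
  have hlim : Tendsto (fun n : ℕ => ((n : ℝ) + 1)⁻¹ * ((∫ x, h x ∂F) * ‖v‖ ^ 2)) atTop (𝓝 0) := by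
    have := (tendsto_one_div_add_atTop_nhds_zero_nat (𝕜 := ℝ)).mul_const
      ((∫ x, h x ∂F) * ‖v‖ ^ 2)
    simpa using this
  exact abs_nonpos_iff.1 (ge_of_tendsto hlim hle)

omit [IsProbabilityMeasure F] in
-- These rescaled remainders serve twice: their limit inherits measurability, and their means
-- identify the mean of W.
theorem tendsto_quadratic (hE : LikelihoodExpansion F θ₀ L u W ρ h H) (v : E) :
    ∀ᵐ x ∂F, Tendsto (fun n : ℕ => 2 * ((n : ℝ) + 1) ^ 2 *
      (L (θ₀ + ((n : ℝ) + 1)⁻¹ • v) x - 1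
        - inner ℝ (u x) (θ₀ + ((n : ℝ) + 1)⁻¹ • v - θ₀))) atTop (𝓝 (W x v v)) := by
  filter_upwards [hE.isLittleO] with x hx
  have h1 := hx.comp_tendsto (tendsto_add_inv_smul θ₀ v)
  have h2 : (fun n : ℕ => (2 * ((n : ℝ) + 1) ^ 2 *
      (L (θ₀ + ((n : ℝ) + 1)⁻¹ • v) x - 1
        - inner ℝ (u x) (θ₀ + ((n : ℝ) + 1)⁻¹ • v - θ₀))) - W x v v)
      =o[atTop] fun _ => (1 : ℝ) := by
    have h3 := (Asymptotics.isBigO_refl (fun n : ℕ => 2 * ((n : ℝ) + 1) ^ 2) atTop).mul_isLittleO h1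
    refine (h3.congr_left fun n => ?_).trans_isBigO ?_
    · have hpos : (n : ℝ) + 1 ≠ 0 := by positivity
      simp only [Function.comp_apply, add_sub_cancel_left, map_smul, smul_apply, smul_eq_mul]
      field_simp
    · refine Asymptotics.IsBigO.of_bound (2 * ‖v‖ ^ 2) (Eventually.of_forall fun n => ?_)
      have hpos : (0 : ℝ) < (n : ℝ) + 1 := by positivity
      simp only [Function.comp_apply, add_sub_cancel_left, norm_smul, norm_mul, norm_pow, norm_inv,
        Real.norm_of_nonneg hpos.le, norm_norm, norm_one]
      rw [Real.norm_of_nonneg zero_le_two]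
      field_simp
      norm_num
  simpa using ((Asymptotics.isLittleO_one_iff ℝ).1 h2).add_const (W x v v)

theorem aestronglyMeasurable_remainder (hE : LikelihoodExpansion F θ₀ L u W ρ h H) {θ : E}
    (hθ : θ ∈ Metric.ball θ₀ ρ) :
    AEStronglyMeasurable (fun x => L θ x - 1 - inner ℝ (u x) (θ - θ₀)) F :=
  (((hE.integrable_ratio hθ).sub (integrable_const _)).sub
    (hE.integrable_inner _)).aestronglyMeasurable

/-- W is only given pointwise, so measurability comes from the measurable functions converging to
it. The shift by n₀ keeps every parameter in the ball. -/
theorem aestronglyMeasurable_quadratic (hE : LikelihoodExpansion F θ₀ L u W ρ h H) (v : E) :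
    AEStronglyMeasurable (fun x => W x v v) F := by
  obtain ⟨n₀, hn₀⟩ := eventually_atTop.1 (hE.eventually_mem_ball v)
  refine aestronglyMeasurable_of_tendsto_ae atTop (f := fun (n : ℕ) x =>
    2 * (((n + n₀ : ℕ) : ℝ) + 1) ^ 2 * (L (θ₀ + (((n + n₀ : ℕ) : ℝ) + 1)⁻¹ • v) x - 1
        - inner ℝ (u x) (θ₀ + (((n + n₀ : ℕ) : ℝ) + 1)⁻¹ • v - θ₀))) (fun n => ?_)
    ((hE.tendsto_quadratic v).mono fun x hx => hx.comp (tendsto_add_atTop_nat n₀))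
  exact (hE.aestronglyMeasurable_remainder (hn₀ _ (by omega))).const_mul _

/-- The approximating functions have mean zero, because the ratio has mean 1 and the score is
centered, and they are dominated by 2 h ‖v‖². -/
theorem integral_quadratic (hE : LikelihoodExpansion F θ₀ L u W ρ h H) (v : E) :
    ∫ x, W x v v ∂F = 0 := by
  obtain ⟨n₀, hn₀⟩ := eventually_atTop.1 (hE.eventually_mem_ball v)
  have hlim := tendsto_integral_of_dominated_convergence (μ := F) (F := fun (n : ℕ) x =>
    2 * (((n + n₀ : ℕ) : ℝ) + 1) ^ 2 * (L (θ₀ + (((n + n₀ : ℕ) : ℝ) + 1)⁻¹ • v) x - 1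
        - inner ℝ (u x) (θ₀ + (((n + n₀ : ℕ) : ℝ) + 1)⁻¹ • v - θ₀))) (f := fun x => W x v v)
    (fun x => 2 * (h x * ‖v‖ ^ 2))
    (fun n => (hE.aestronglyMeasurable_remainder (hn₀ _ (by omega))).const_mul _)
    ((hE.integrable_h.mul_const _).const_mul _) (fun n => by
      filter_upwards [hE.abs_sub_le] with x hx
      have h1 := hx _ (hn₀ (n + n₀) (by omega))
      have hpos : (0 : ℝ) < ((n + n₀ : ℕ) : ℝ) + 1 := by positivity
      rw [norm_mul, Real.norm_of_nonneg (by positivity), Real.norm_eq_abs]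
      calc _ ≤ 2 * (((n + n₀ : ℕ) : ℝ) + 1) ^ 2 *
          (h x * ‖θ₀ + (((n + n₀ : ℕ) : ℝ) + 1)⁻¹ • v - θ₀‖ ^ 2) := by gcongr
        _ = _ := by
          simp only [add_sub_cancel_left, norm_smul, norm_inv, Real.norm_of_nonneg hpos.le]
          field_simp)
    ((hE.tendsto_quadratic v).mono fun x hx => hx.comp (tendsto_add_atTop_nat n₀))
  have hz : ∀ n : ℕ, ∫ x, 2 * (((n + n₀ : ℕ) : ℝ) + 1) ^ 2 *
      (L (θ₀ + (((n + n₀ : ℕ) : ℝ) + 1)⁻¹ • v) x - 1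
        - inner ℝ (u x) (θ₀ + (((n + n₀ : ℕ) : ℝ) + 1)⁻¹ • v - θ₀)) ∂F = 0 := fun n => by
    rw [integral_const_mul, hE.integral_remainder (hn₀ _ (by omega)), hE.integral_inner_score]
    simp
  simp only [hz] at hlim
  exact (tendsto_nhds_unique hlim tendsto_const_nhds)

omit [IsProbabilityMeasure F] in
theorem polarization (hE : LikelihoodExpansion F θ₀ L u W ρ h H) (v w : E) :
    (fun x => (1 / 2) * (W x (v + w) (v + w) - W x v v - W x w w)) =ᵐ[F] fun x => W x v w := by
  filter_upwards [hE.symm] with x hx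
  simp only [map_add, add_apply, hx w v]
  ring

theorem integrable_second (hE : LikelihoodExpansion F θ₀ L u W ρ h H) (v w : E) :
    Integrable (fun x => W x v w) F := by
  refine ((hE.integrable_h.mul_const ‖v‖).mul_const ‖w‖).mono' ?_
    (hE.abs_apply_le.mono fun x hx => hx v w)
  refine AEStronglyMeasurable.congr ?_ (hE.polarization v w)
  exact (((hE.aestronglyMeasurable_quadratic _).sub (hE.aestronglyMeasurable_quadratic _)).sub
    (hE.aestronglyMeasurable_quadratic _)).const_mul _

/-- The second derivative of the likelihood ratio has mean zero. -/
theorem integral_second (hE : LikelihoodExpansion F θ₀ L u W ρ h H) (v w : E) :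
    ∫ x, W x v w ∂F = 0 := by
  rw [← integral_congr_ae (hE.polarization v w), integral_const_mul,
    integral_sub ((hE.integrable_second _ _).sub' (hE.integrable_second _ _))
      (hE.integrable_second _ _),
    integral_sub (hE.integrable_second _ _) (hE.integrable_second _ _)]
  simp only [hE.integral_quadratic]
  norm_num

omit [IsProbabilityMeasure F] in
theorem memLp_inner (hE : LikelihoodExpansion F θ₀ L u W ρ h H) (v : E) :
    MemLp (fun x => inner ℝ (u x) v) 2 F :=
  hE.memLp.inner_const v

omit [IsProbabilityMeasure F] in
theorem integrable_inner_mul_inner (hE : LikelihoodExpansion F θ₀ L u W ρ h H) (v w : E) :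
    Integrable (fun x => inner ℝ (u x) v * inner ℝ (u x) w) F :=
  (hE.memLp_inner v).integrable_mul (hE.memLp_inner w)

end LikelihoodExpansion

end ScoreMoments

/-! ### Events of probability tending to one -/

section HighProbability

variable {Ω : Type*} [MeasurableSpace Ω] {P : Measure Ω}

/-- The events `q m` hold with (outer) probability tending to one. -/
def WithHighProb (P : Measure Ω) (q : ℕ → Ω → Prop) : Prop :=
  Tendsto (fun m : ℕ => P {ω | ¬ q m ω}) atTop (𝓝 0)

namespace WithHighProb

theorem mono {q r : ℕ → Ω → Prop} (hq : WithHighProb P q)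
    (h : ∀ᶠ m in atTop, ∀ ω, q m ω → r m ω) : WithHighProb P r := by
  refine tendsto_of_tendsto_of_tendsto_of_le_of_le' tendsto_const_nhds hq
    (Eventually.of_forall fun _ => zero_le) ?_
  filter_upwards [h] with m hm
  exact measure_mono fun ω hω hc => hω (hm ω hc)

theorem and {q r : ℕ → Ω → Prop} (hq : WithHighProb P q) (hr : WithHighProb P r) :
    WithHighProb P fun m ω => q m ω ∧ r m ω := by
  have hs := hq.add hr
  rw [add_zero] at hs
  refine tendsto_of_tendsto_of_tendsto_of_le_of_le tendsto_const_nhds hs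
    (fun _ => zero_le) fun m => ?_
  refine (measure_mono ?_).trans (measure_union_le _ _)
  intro ω hω
  by_cases h : q m ω
  · exact Or.inr fun hc => hω ⟨h, hc⟩
  · exact Or.inl h

theorem of_ae {q : ℕ → Ω → Prop} (h : ∀ m, ∀ᵐ ω ∂P, q m ω) : WithHighProb P q := by
  have : (fun m => P {ω | ¬ q m ω}) = fun _ => 0 := funext fun m => ae_iff.1 (h m)
  rw [WithHighProb, this]
  exact tendsto_const_nhds

theorem comp_tendsto {q : ℕ → Ω → Prop} (hq : WithHighProb P q) {φ : ℕ → ℕ}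
    (hφ : Tendsto φ atTop atTop) : WithHighProb P fun m => q (φ m) :=
  Tendsto.comp (g := fun m : ℕ => P {ω | ¬ q m ω}) hq hφ

theorem finset_all {ι : Type*} (s : Finset ι) {q : ι → ℕ → Ω → Prop}
    (h : ∀ i ∈ s, WithHighProb P (q i)) : WithHighProb P fun m ω => ∀ i ∈ s, q i m ω := by
  classical
  induction s using Finset.induction_on with
  | empty => exact of_ae fun m => by simp
  | insert i s hi ih =>
    refine ((h i (by simp)).and (ih fun j hj => h j (by simp [hj]))).mono
      (Eventually.of_forall fun m ω hω => ?_)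
    simpa using hω

theorem of_tendstoInMeasure {Y : ℕ → Ω → ℝ} {c ε : ℝ}
    (h : TendstoInMeasure P Y atTop fun _ => c) (hε : 0 < ε) :
    WithHighProb P fun m ω => |Y m ω - c| < ε := by
  have := tendstoInMeasure_iff_norm.1 h ε hε
  simpa [WithHighProb, Real.norm_eq_abs] using this

/-- Markov's inequality as a tail bound for a nonnegative random variable. -/
theorem measure_ge_le {Y : Ω → ℝ} (hY : Integrable Y P) (h0 : ∀ ω, 0 ≤ Y ω) {ε : ℝ}
    (hε : 0 < ε) : P {ω | ε ≤ Y ω} ≤ ENNReal.ofReal ((∫ ω, Y ω ∂P) / ε) := by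
  have h1 := mul_meas_ge_le_integral_of_nonneg (Eventually.of_forall h0) hY ε
  have h2 : P {ω | ε ≤ Y ω} ≠ ∞ := (hY.measure_ge_lt_top hε).ne
  rw [← ENNReal.ofReal_toReal h2]
  refine ENNReal.ofReal_le_ofReal ?_
  rw [le_div_iff₀ hε, mul_comm]
  exact h1

theorem of_integral_tendsto {Y : ℕ → Ω → ℝ} (hY : ∀ m, Integrable (Y m) P)
    (h0 : ∀ m ω, 0 ≤ Y m ω) (hlim : Tendsto (fun m => ∫ ω, Y m ω ∂P) atTop (𝓝 0)) {ε : ℝ}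
    (hε : 0 < ε) : WithHighProb P fun m ω => Y m ω < ε := by
  have h1 : Tendsto (fun m => ENNReal.ofReal ((∫ ω, Y m ω ∂P) / ε)) atTop (𝓝 0) := by
    have := ENNReal.tendsto_ofReal (hlim.div_const ε)
    simpa using this
  refine tendsto_of_tendsto_of_tendsto_of_le_of_le tendsto_const_nhds h1
    (fun _ => zero_le) fun m => ?_
  simpa using measure_ge_le (hY m) (h0 m) hε

end WithHighProb

end HighProbability

/-! ### Samples and the law of large numbers -/

section Sample

variable {S : Type*} [MeasurableSpace S] {Ω : Type*} [MeasurableSpace Ω] {P : Measure Ω}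

/-- `X` is a sequence of pairwise independent observations from `F`. -/
structure IsPairwiseSample (P : Measure Ω) (F : Measure S) (X : ℕ → Ω → S) : Prop where
  measurable : ∀ i, Measurable (X i)
  map_eq : ∀ i, P.map (X i) = F
  indep : Pairwise fun i j => IndepFun (X i) (X j) P

namespace IsPairwiseSample

variable {F : Measure S} {X : ℕ → Ω → S}

theorem measurePreserving (hX : IsPairwiseSample P F X) (i : ℕ) : MeasurePreserving (X i) P F :=
  ⟨hX.measurable i, hX.map_eq i⟩

theorem ae_all (hX : IsPairwiseSample P F X) {q : S → Prop} (h : ∀ᵐ x ∂F, q x) :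
    ∀ᵐ ω ∂P, ∀ i, q (X i ω) :=
  ae_all_iff.2 fun i => (hX.measurePreserving i).quasiMeasurePreserving.ae h

theorem integrable_comp {V : Type*} [NormedAddCommGroup V] (hX : IsPairwiseSample P F X) {φ : S → V}
    (hφ : Integrable φ F) (i : ℕ) : Integrable (fun ω => φ (X i ω)) P :=
  (hX.measurePreserving i).integrable_comp_of_integrable hφ

theorem integral_comp {V : Type*} [NormedAddCommGroup V] [NormedSpace ℝ V]
    (hX : IsPairwiseSample P F X) {φ : S → V}
    (hφ : AEStronglyMeasurable φ F) (i : ℕ) : ∫ ω, φ (X i ω) ∂P = ∫ x, φ x ∂F := by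
  rw [← hX.map_eq i] at hφ ⊢
  exact (integral_map (hX.measurable i).aemeasurable hφ).symm

theorem indepFun_comp {V V' : Type*} [MeasurableSpace V] [MeasurableSpace V']
    (hX : IsPairwiseSample P F X) {φ : S → V} {ψ : S → V'} (hφ : AEMeasurable φ F)
    (hψ : AEMeasurable ψ F) {i j : ℕ} (hij : i ≠ j) :
    IndepFun (fun ω => φ (X i ω)) (fun ω => ψ (X j ω)) P :=
  (hX.indep hij).comp₀ (hX.measurable i).aemeasurable (hX.measurable j).aemeasurable
    (by rwa [hX.map_eq i]) (by rwa [hX.map_eq j])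

theorem identDistrib_comp {V : Type*} [MeasurableSpace V] (hX : IsPairwiseSample P F X) {φ : S → V}
    (hφ : AEMeasurable φ F) (i j : ℕ) :
    IdentDistrib (fun ω => φ (X i ω)) (fun ω => φ (X j ω)) P P := by
  have h : IdentDistrib (X i) (X j) P P :=
    ⟨(hX.measurable i).aemeasurable, (hX.measurable j).aemeasurable,
      by rw [hX.map_eq i, hX.map_eq j]⟩
  exact h.comp_of_aemeasurable (by rwa [hX.map_eq i])

/-- The weak law of large numbers. -/
theorem tendstoInMeasure_mean [IsFiniteMeasure P] (hX : IsPairwiseSample P F X) {φ : S → ℝ}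
    (hφ : Integrable φ F) :
    TendstoInMeasure P (fun m ω => (∑ i ∈ Finset.range m, φ (X i ω)) / m) atTop
      fun _ => ∫ x, φ x ∂F := by
  have hm : AEMeasurable φ F := hφ.aestronglyMeasurable.aemeasurable
  refine tendstoInMeasure_of_tendsto_ae (fun m => ?_) ?_
  · simp only [div_eq_mul_inv]
    exact (integrable_finsetSum _ fun i _ => hX.integrable_comp hφ i).aestronglyMeasurable.mul_const
      _
  · have := strong_law_ae_real (fun i ω => φ (X i ω)) (hX.integrable_comp hφ 0)
      (fun i j hij => hX.indepFun_comp hm hm hij) fun i => hX.identDistrib_comp hm i 0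
    rwa [hX.integral_comp hφ.aestronglyMeasurable] at this

theorem withHighProb_mean [IsFiniteMeasure P] (hX : IsPairwiseSample P F X) {φ : S → ℝ}
    (hφ : Integrable φ F) {ε : ℝ} (hε : 0 < ε) :
    WithHighProb P fun m ω =>
      |(∑ i ∈ Finset.range m, φ (X i ω)) / m - ∫ x, φ x ∂F| < ε :=
  .of_tendstoInMeasure (hX.tendstoInMeasure_mean hφ) hε

end IsPairwiseSample

end Sample

/-! ### Uniform quadratic expansion of the log likelihood -/

section LocalQuadratic

variable {S : Type*} [MeasurableSpace S] {E : Type*} [NormedAddCommGroup E]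
  [InnerProductSpace ℝ E] {F : Measure S} [IsProbabilityMeasure F] {θ₀ : E} {L : E → S → ℝ}
  {u : S → E} {W : S → E →L[ℝ] E →L[ℝ] ℝ} {ρ : ℝ} {h H : S → ℝ}

/-- The remainder of the second order expansion of the log likelihood ratio. -/
noncomputable def logRemainder (θ₀ : E) (L : E → S → ℝ) (u : S → E)
    (W : S → E →L[ℝ] E →L[ℝ] ℝ) (θ : E)
    (x : S) : ℝ :=
  Real.log (L θ x) - inner ℝ (u x) (θ - θ₀)
    - (1 / 2) * (W x (θ - θ₀) (θ - θ₀) - inner ℝ (u x) (θ - θ₀) ^ 2)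

namespace LikelihoodExpansion

theorem aemeasurable_logRemainder (hE : LikelihoodExpansion F θ₀ L u W ρ h H) {θ : E}
    (hθ : θ ∈ Metric.ball θ₀ ρ) : AEMeasurable (logRemainder θ₀ L u W θ) F := by
  have h1 : AEMeasurable (fun x => inner ℝ (u x) (θ - θ₀)) F :=
    (hE.integrable_inner _).aestronglyMeasurable.aemeasurable
  have h2 := (hE.integrable_second (θ - θ₀) (θ - θ₀)).aestronglyMeasurable.aemeasurable
  have h3 : AEMeasurable (fun x => Real.log (L θ x)) F := (hE.measurable θ hθ).log.aemeasurable
  exact (h3.sub h1).sub ((h2.sub (h1.pow_const 2)).const_mul _)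

omit [IsProbabilityMeasure F] in
theorem logRemainder_isLittleO (hE : LikelihoodExpansion F θ₀ L u W ρ h H) :
    ∀ᵐ x ∂F, (fun θ => logRemainder θ₀ L u W θ x) =o[𝓝 θ₀] fun θ => ‖θ - θ₀‖ ^ 2 := by
  filter_upwards [hE.isLittleO] with x hx
  exact log_isLittleO_of_isLittleO (ℓ := innerSL ℝ (u x)) hx

omit [IsProbabilityMeasure F] in
theorem abs_logRemainder_le (hE : LikelihoodExpansion F θ₀ L u W ρ h H) :
    ∀ᵐ x ∂F, ∀ θ ∈ Metric.ball θ₀ ρ,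
      |logRemainder θ₀ L u W θ x| ≤ (|H x| + |h x| + ‖u x‖ ^ 2) * ‖θ - θ₀‖ ^ 2 := by
  filter_upwards [hE.abs_log_sub_le, hE.abs_apply_le] with x h1 h2 θ hθ
  have hs : 0 ≤ ‖θ - θ₀‖ ^ 2 := by positivity
  have a1 := abs_le.1 ((h1 θ hθ).trans (mul_le_mul_of_nonneg_right (le_abs_self (H x)) hs))
  have a2 := abs_le.1 ((h2 (θ - θ₀) (θ - θ₀)).trans_eq (by ring : _ = h x * ‖θ - θ₀‖ ^ 2) |>.trans
    (mul_le_mul_of_nonneg_right (le_abs_self (h x)) hs))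
  have a3 : inner ℝ (u x) (θ - θ₀) ^ 2 ≤ (‖u x‖ * ‖θ - θ₀‖) ^ 2 :=
    sq_le_sq.2 ((abs_real_inner_le_norm _ _).trans (le_abs_self _))
  have a4 := sq_nonneg (inner ℝ (u x) (θ - θ₀))
  rw [mul_pow] at a3
  rw [logRemainder, abs_le]
  have a5 : 0 ≤ ‖u x‖ ^ 2 * ‖θ - θ₀‖ ^ 2 := by positivity
  have a6 : 0 ≤ |h x| * ‖θ - θ₀‖ ^ 2 := by positivity
  constructor <;> nlinarith

/-- Measurable envelopes of the remainder on shrinking balls, with vanishing mean. -/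
theorem exists_envelope [FiniteDimensional ℝ E] (hE : LikelihoodExpansion F θ₀ L u W ρ h H) :
    ∃ R : ℕ → S → ℝ, (∀ n, Integrable (R n) F) ∧ Tendsto (fun n : ℕ => ∫ x, R n x ∂F) atTop (𝓝 0) ∧
      ∀ n : ℕ, ∀ᵐ x ∂F, ∀ θ ∈ Metric.ball θ₀ (ρ / ((n : ℝ) + 1)),
        |logRemainder θ₀ L u W θ x| ≤ R n x * ‖θ - θ₀‖ ^ 2 := by
  classical
  have hprop : ProperSpace E := FiniteDimensional.proper_real E
  set d := TopologicalSpace.denseSeq E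
  have hdd : DenseRange d := TopologicalSpace.denseRange_denseSeq E
  have hsub : ∀ n : ℕ, Metric.ball θ₀ (ρ / ((n : ℝ) + 1)) ⊆ Metric.ball θ₀ ρ := fun n =>
    Metric.ball_subset_ball (div_le_self hE.radius_pos.le (by linarith [n.cast_nonneg (α := ℝ)]))
  -- A supremum over all θ in the ball need not be measurable; over the countable dense sequence d
  -- it is. The value 0 outside the ball does not affect a supremum of nonnegative terms.
  set r : ℕ → ℕ → S → ℝ := fun n k x =>
    if d k ∈ Metric.ball θ₀ (ρ / ((n : ℝ) + 1)) then
      |logRemainder θ₀ L u W (d k) x| / ‖d k - θ₀‖ ^ 2 else 0 with hr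
  set G : S → ℝ := fun x => |H x| + |h x| + ‖u x‖ ^ 2 with hG
  have hGint : Integrable G F :=
    (hE.integrable_H.abs.add hE.integrable_h.abs).add hE.memLp.integrable_norm_pow'
  have hG0 : ∀ x, 0 ≤ G x := fun x => by positivity
  have hr0 : ∀ n k x, 0 ≤ r n k x := fun n k x => by
    simp only [hr]
    split_ifs <;> positivity
  have hrG : ∀ᵐ x ∂F, ∀ n k, r n k x ≤ G x := by
    filter_upwards [hE.abs_logRemainder_le] with x hx n k
    simp only [hr]
    split_ifs with hk
    · exact div_le_of_le_mul₀ (by positivity) (hG0 x) (hx _ (hsub n hk))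
    · exact hG0 x
  have hrm : ∀ n k, AEMeasurable (r n k) F := fun n k => by
    by_cases hk : d k ∈ Metric.ball θ₀ (ρ / ((n : ℝ) + 1))
    · simp only [hr, if_pos hk]
      exact (measurable_norm.comp_aemeasurable
        (hE.aemeasurable_logRemainder (hsub n hk))).div_const _
    · simp only [hr, if_neg hk]
      exact aemeasurable_const
  have hbdd : ∀ᵐ x ∂F, ∀ n, BddAbove (Set.range fun k => r n k x) := by
    filter_upwards [hrG] with x hx n
    exact ⟨G x, by rintro _ ⟨k, rfl⟩; exact hx n k⟩
  have hRm : ∀ n, AEMeasurable (fun x => ⨆ k, r n k x) F := fun n => .iSup (hrm n)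
  have hR0 : ∀ n x, 0 ≤ ⨆ k, r n k x := fun n x => Real.iSup_nonneg fun k => hr0 n k x
  have hRG : ∀ n, ∀ᵐ x ∂F, ‖⨆ k, r n k x‖ ≤ G x := fun n => by
    filter_upwards [hrG] with x hx
    rw [Real.norm_of_nonneg (hR0 n x)]
    exact ciSup_le (hx n)
  refine ⟨fun n x => ⨆ k, r n k x, fun n => hGint.mono' (hRm n).aestronglyMeasurable (hRG n),
    ?_, fun n => ?_⟩
  · have hlim : ∀ᵐ x ∂F, Tendsto (fun n => ⨆ k, r n k x) atTop (𝓝 0) := by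
      filter_upwards [hE.logRemainder_isLittleO] with x hx
      rw [Metric.tendsto_atTop]
      intro ε hε
      obtain ⟨s, hs, hball⟩ := Metric.eventually_nhds_iff_ball.1
        (Asymptotics.isLittleO_iff.1 hx (half_pos hε))
      have htend : Tendsto (fun n : ℕ => ρ / ((n : ℝ) + 1)) atTop (𝓝 0) := by
        simpa [div_eq_mul_inv] using
          (tendsto_one_div_add_atTop_nhds_zero_nat (𝕜 := ℝ)).const_mul ρ
      obtain ⟨n₀, hn₀⟩ := eventually_atTop.1 (htend.eventually_lt_const hs)
      refine ⟨n₀, fun n hn => ?_⟩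
      rw [Real.dist_eq, sub_zero, abs_of_nonneg (hR0 n x)]
      refine lt_of_le_of_lt (ciSup_le fun k => ?_) (half_lt_self hε)
      simp only [hr]
      split_ifs with hk
      · refine div_le_of_le_mul₀ (by positivity) (by positivity) ?_
        have := hball (d k) (Metric.ball_subset_ball (hn₀ n hn).le hk)
        rwa [Real.norm_eq_abs, Real.norm_of_nonneg (by positivity)] at this
      · positivity
    simpa using tendsto_integral_of_dominated_convergence G
      (fun n => (hRm n).aestronglyMeasurable) hGint hRG hlim
  · filter_upwards [hE.pos, hE.continuousOn, hbdd, hE.abs_logRemainder_le] with x hpos hc hb hG θ hθ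
    by_contra hcon
    push Not at hcon
    -- By continuity in θ, a violation of the bound would persist on an open set, hence occur at
    -- some d k, against the definition of the supremum.
    have hcont : ContinuousOn (fun θ => |logRemainder θ₀ L u W θ x|
        - (⨆ k, r n k x) * ‖θ - θ₀‖ ^ 2) (Metric.ball θ₀ (ρ / ((n : ℝ) + 1))) := by
      have h1 : ContinuousOn (fun θ => Real.log (L θ x)) (Metric.ball θ₀ (ρ / ((n : ℝ) + 1))) :=
        (hc.mono (hsub n)).log fun θ hθ => (hpos θ (hsub n hθ)).ne'
      unfold logRemainder
      fun_prop
    have hopen := hcont.isOpen_inter_preimage Metric.isOpen_ball (isOpen_Ioi (a := (0 : ℝ)))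
    obtain ⟨k, hk⟩ := hdd.exists_mem_open hopen ⟨θ, hθ, by simpa using hcon⟩
    have hk2 : (⨆ k, r n k x) * ‖d k - θ₀‖ ^ 2 < |logRemainder θ₀ L u W (d k) x| := by
      simpa using hk.2
    have hne : 0 < ‖d k - θ₀‖ ^ 2 := by
      by_contra hz
      have hz' : ‖d k - θ₀‖ ^ 2 = 0 := le_antisymm (not_lt.1 hz) (by positivity)
      have := hG (d k) (hsub n hk.1)
      rw [hz', mul_zero] at this hk2
      exact absurd hk2 (not_lt.2 this)
    have hle : r n k x ≤ ⨆ k, r n k x := le_ciSup (hb n) k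
    simp only [hr] at hle
    rw [if_pos hk.1, div_le_iff₀ hne] at hle
    exact absurd hk2 (not_lt.2 hle)

/-- The quadratic expansion of the normalized log likelihood ratio, uniformly near `θ₀`. -/
theorem withHighProb_loglik {Ω : Type*} [MeasurableSpace Ω] {P : Measure Ω} [IsFiniteMeasure P]
    [FiniteDimensional ℝ E] (hE : LikelihoodExpansion F θ₀ L u W ρ h H) {X : ℕ → Ω → S}
    (hX : IsPairwiseSample P F X) {η : ℝ} (hη : 0 < η) :
    ∃ r, 0 < r ∧ r ≤ ρ ∧ WithHighProb P fun m ω => ∀ θ ∈ Metric.ball θ₀ r,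
      |(∑ i ∈ Finset.range m, Real.log (L θ (X i ω))) / m
        - inner ℝ ((m : ℝ)⁻¹ • ∑ i ∈ Finset.range m, u (X i ω)) (θ - θ₀)
        + (1 / 2) * ∫ x, inner ℝ (u x) (θ - θ₀) ^ 2 ∂F| ≤ η * ‖θ - θ₀‖ ^ 2 := by
  obtain ⟨R, hRint, hRlim, hR⟩ := hE.exists_envelope
  -- Mean at most η/4 plus a deviation of η/4 gives η/2 for the remainder; the quadratic part takes
  -- the other η/2.
  obtain ⟨n, hn⟩ := (hRlim.eventually_lt_const (show (0 : ℝ) < η / 4 by positivity)).exists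
  have hρn : 0 < ρ / ((n : ℝ) + 1) := div_pos hE.radius_pos (by positivity)
  refine ⟨ρ / ((n : ℝ) + 1), hρn,
    div_le_self hE.radius_pos.le (by linarith [n.cast_nonneg (α := ℝ)]), ?_⟩
  set b := stdOrthonormalBasis ℝ E
  set ι := Fin (Module.finrank ℝ E)
  -- Entries of the Hessian of log L at θ₀. As W has mean zero their mean is minus the information,
  -- and the law of large numbers for these finitely many entries is uniform in the direction.
  set B : ι → ι → S → ℝ := fun i j x =>
    W x (b i) (b j) - inner ℝ (u x) (b i) * inner ℝ (u x) (b j) with hB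
  have hBint : ∀ i j, Integrable (B i j) F := fun i j =>
    (hE.integrable_second _ _).sub (hE.integrable_inner_mul_inner _ _)
  have hBmean : ∀ i j, ∫ x, B i j x ∂F = - ∫ x, inner ℝ (u x) (b i) * inner ℝ (u x) (b j) ∂F :=
    fun i j => by
      rw [hB, integral_sub (hE.integrable_second _ _) (hE.integrable_inner_mul_inner _ _),
        hE.integral_second, zero_sub]
  -- Tolerance for each of the card² entries; the + 1 keeps it positive in dimension 0.
  set κ : ℝ := η / (Fintype.card ι * Fintype.card ι + 1) with hκ
  have hκ0 : 0 < κ := by positivity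
  have hexp : ∀ v : E, v = ∑ i, b.repr v i • b i := fun v => (b.sum_repr v).symm
  have hcoord : ∀ (v : E) i, |b.repr v i| ≤ ‖v‖ := fun v i => by
    rw [b.repr_apply_apply]
    exact (abs_real_inner_le_norm _ _).trans (by simp)
  have hquad : ∀ x v, W x v v - inner ℝ (u x) v ^ 2
      = ∑ i, ∑ j, b.repr v i * b.repr v j * B i j x := fun x v => by
    have h1 : W x v v = ∑ i, ∑ j, b.repr v i * b.repr v j * W x (b i) (b j) := by
      conv_lhs => rw [hexp v]
      simp only [map_sum, map_smul, sum_apply, smul_apply, smul_eq_mul,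
        Finset.mul_sum]
      rw [Finset.sum_comm]
      exact Finset.sum_congr rfl fun i _ => Finset.sum_congr rfl fun j _ => by ring
    have h2 : inner ℝ (u x) v = ∑ i, b.repr v i * inner ℝ (u x) (b i) := by
      conv_lhs => rw [hexp v]
      simp only [inner_sum, inner_smul_right]
    rw [h1, h2, sq, Finset.sum_mul_sum, ← Finset.sum_sub_distrib]
    refine Finset.sum_congr rfl fun i _ => ?_
    rw [← Finset.sum_sub_distrib]
    exact Finset.sum_congr rfl fun j _ => by simp only [hB]; ring
  have hinfo : ∀ v, - ∫ x, inner ℝ (u x) v ^ 2 ∂F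
      = ∑ i, ∑ j, b.repr v i * b.repr v j * ∫ x, B i j x ∂F := fun v => by
    have h3 : ∫ x, (W x v v - inner ℝ (u x) v ^ 2) ∂F = - ∫ x, inner ℝ (u x) v ^ 2 ∂F := by
      have := hE.integrable_inner_mul_inner v v
      simp only [← sq] at this
      rw [integral_sub (hE.integrable_second _ _) this, hE.integral_second, zero_sub]
    rw [← h3]
    simp only [hquad]
    rw [integral_finsetSum _ fun i _ => integrable_finsetSum _ fun j _ =>
      (hBint i j).const_mul _]
    refine Finset.sum_congr rfl fun i _ => ?_
    rw [integral_finsetSum _ fun j _ => (hBint i j).const_mul _]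
    exact Finset.sum_congr rfl fun j _ => integral_const_mul _ _
  have hW1 : WithHighProb P fun m ω => ∀ q ∈ (Finset.univ : Finset (ι × ι)),
      |(∑ k ∈ Finset.range m, B q.1 q.2 (X k ω)) / m - ∫ x, B q.1 q.2 x ∂F| < κ :=
    WithHighProb.finset_all _ fun q _ => hX.withHighProb_mean (hBint q.1 q.2) hκ0
  have hW2 := hX.withHighProb_mean (hRint n) (show (0 : ℝ) < η / 4 by positivity)
  have hW3 : WithHighProb P fun _ ω => ∀ i, ∀ θ ∈ Metric.ball θ₀ (ρ / ((n : ℝ) + 1)),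
      |logRemainder θ₀ L u W θ (X i ω)| ≤ R n (X i ω) * ‖θ - θ₀‖ ^ 2 :=
    .of_ae fun _ => hX.ae_all (hR n)
  refine ((hW1.and hW2).and hW3).mono ((eventually_gt_atTop 0).mono ?_)
  rintro m hm ω ⟨⟨h1, h2⟩, h3⟩ θ hθ
  have hm0 : (0 : ℝ) < m := by exact_mod_cast hm
  set v := θ - θ₀ with hv
  have key : (∑ i ∈ Finset.range m, Real.log (L θ (X i ω))) / m
        - inner ℝ ((m : ℝ)⁻¹ • ∑ i ∈ Finset.range m, u (X i ω)) v
        + (1 / 2) * ∫ x, inner ℝ (u x) v ^ 2 ∂F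
      = (∑ k ∈ Finset.range m, logRemainder θ₀ L u W θ (X k ω)) / m
        + (1 / 2) * ∑ i, ∑ j, b.repr v i * b.repr v j *
          ((∑ k ∈ Finset.range m, B i j (X k ω)) / m - ∫ x, B i j x ∂F) := by
    have e1 : ∑ i, ∑ j, b.repr v i * b.repr v j *
          ((∑ k ∈ Finset.range m, B i j (X k ω)) / m - ∫ x, B i j x ∂F)
        = (∑ k ∈ Finset.range m, (W (X k ω) v v - inner ℝ (u (X k ω)) v ^ 2)) / m
          + ∫ x, inner ℝ (u x) v ^ 2 ∂F := by
      simp only [mul_sub, Finset.sum_sub_distrib, ← hinfo v, hquad]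
      rw [sub_neg_eq_add]
      congr 1
      simp only [Finset.sum_div, Finset.mul_sum]
      rw [Finset.sum_comm (s := Finset.range m)]
      refine Finset.sum_congr rfl fun i _ => ?_
      rw [Finset.sum_comm (s := Finset.range m)]
      refine Finset.sum_congr rfl fun j _ => Finset.sum_congr rfl fun k _ => ?_
      ring
    rw [e1]
    simp only [logRemainder, Finset.sum_sub_distrib, ← Finset.mul_sum, inner_smul_left, sum_inner]
    simp only [← hv, conj_trivial]
    field_simp
    ring
  have hpart1 : |(∑ k ∈ Finset.range m, logRemainder θ₀ L u W θ (X k ω)) / m|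
      ≤ η / 2 * ‖v‖ ^ 2 := by
    rw [abs_div, abs_of_pos hm0, div_le_iff₀ hm0]
    have hs : |∑ k ∈ Finset.range m, logRemainder θ₀ L u W θ (X k ω)|
        ≤ (∑ k ∈ Finset.range m, R n (X k ω)) * ‖v‖ ^ 2 := by
      rw [Finset.sum_mul]
      exact (Finset.abs_sum_le_sum_abs _ _).trans (Finset.sum_le_sum fun k _ => h3 k θ hθ)
    have hmean : (∑ k ∈ Finset.range m, R n (X k ω)) ≤ η / 2 * m := by
      rw [← div_le_iff₀ hm0]
      have := (abs_lt.1 h2).2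
      linarith
    calc _ ≤ _ := hs
      _ ≤ (η / 2 * m) * ‖v‖ ^ 2 := by gcongr
      _ = _ := by ring
  have hpart2 : |∑ i, ∑ j, b.repr v i * b.repr v j *
          ((∑ k ∈ Finset.range m, B i j (X k ω)) / m - ∫ x, B i j x ∂F)| ≤ η * ‖v‖ ^ 2 := by
    calc _ ≤ ∑ i : ι, ∑ j : ι, ‖v‖ * ‖v‖ * κ := by
          refine (Finset.abs_sum_le_sum_abs _ _).trans (Finset.sum_le_sum fun i _ => ?_)
          refine (Finset.abs_sum_le_sum_abs _ _).trans (Finset.sum_le_sum fun j _ => ?_)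
          rw [abs_mul, abs_mul]
          have := (h1 (i, j) (Finset.mem_univ _)).le
          have := hcoord v i
          have := hcoord v j
          gcongr
      _ = (Fintype.card ι * Fintype.card ι * κ) * ‖v‖ ^ 2 := by
          simp only [Finset.sum_const, Finset.card_univ, nsmul_eq_mul]
          ring
      _ ≤ η * ‖v‖ ^ 2 := by
          gcongr
          rw [hκ, mul_div_assoc', div_le_iff₀ (by positivity)]
          nlinarith
  rw [key]
  calc _ ≤ η / 2 * ‖v‖ ^ 2 + 1 / 2 * (η * ‖v‖ ^ 2) := by
        refine (abs_add_le _ _).trans ?_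
        rw [abs_mul, abs_of_pos (show (0 : ℝ) < 1 / 2 by norm_num)]
        gcongr
    _ = _ := by ring

end LikelihoodExpansion

end LocalQuadratic

/-! ### Products over blocks and cyclic windows -/

section Products

theorem prod_range_mul {M : Type*} [CommMonoid M] (r : ℕ → M) (q k : ℕ) :
    ∏ i ∈ Finset.range (q * k), r i
      = ∏ c ∈ Finset.range q, ∏ l : Fin k, r (c * k + l) := by
  induction q with
  | zero => simp
  | succ q ih =>
    rw [Nat.succ_mul, Finset.prod_range_add, ih, Finset.prod_range_succ,
      Fin.prod_univ_eq_prod_range (fun l => r (q * k + l)) k]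

theorem prod_range_rotate {M : Type*} [CommMonoid M] (r : ℕ → M) (s l : ℕ) :
    ∏ j ∈ Finset.range s, r ((j + l) % s) = ∏ j ∈ Finset.range s, r j := by
  rcases Nat.eq_zero_or_pos s with rfl | hs
  · simp
  · have : NeZero s := ⟨hs.ne'⟩
    rw [← Fin.prod_univ_eq_prod_range (fun j => r ((j + l) % s)) s,
      ← Fin.prod_univ_eq_prod_range r s,
      ← Equiv.prod_comp (Equiv.addRight (Fin.ofNat s l)) fun j : Fin s => r j]
    refine Finset.prod_congr rfl fun j _ => ?_
    simp [Fin.val_add]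

/-- A `k`-th power of a product over `q * k + s` indices, as a product over `q` consecutive blocks
of length `k` and `s` cyclic windows of length `k` among the last `s` indices. -/
theorem prod_range_pow_eq {M : Type*} [CommMonoid M] (r : ℕ → M) (q k s : ℕ) :
    (∏ i ∈ Finset.range (q * k + s), r i) ^ k
      = (∏ c ∈ Finset.range q, ∏ l : Fin k, r (c * k + l)) ^ k
        * ∏ j ∈ Finset.range s, ∏ l : Fin k, r (q * k + (j + l) % s) := by
  rw [Finset.prod_range_add, mul_pow, prod_range_mul, Finset.prod_comm (s := Finset.range s)]
  congr 1
  simp only [prod_range_rotate (fun j => r (q * k + j))]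
  simp

/-- A window no longer than the cycle does not meet itself, so it consists of k distinct
observations. -/
theorem injective_cyclic_window (a j : ℕ) {k s : ℕ} (hks : k ≤ s) :
    Function.Injective fun l : Fin k => a + (j + (l : ℕ)) % s := by
  intro l l' hll
  have h1 : (j + l : ℕ) ≡ j + l' [MOD s] := Nat.add_left_cancel hll
  have h2 : (l : ℕ) ≡ l' [MOD s] := Nat.ModEq.add_left_cancel' j h1
  exact Fin.ext (h2.eq_of_lt_of_lt (l.2.trans_le hks) (l'.2.trans_le hks))

end Products

/-! ### Tuples of independent observations -/

section Tuples

variable {S : Type*} [MeasurableSpace S] {Ω : Type*} [MeasurableSpace Ω] {P : Measure Ω}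
  {F : Measure S} {X : ℕ → Ω → S}

theorem IsPairwiseSample.of_iIndepFun (hX : ∀ i, Measurable (X i)) (hlaw : ∀ i, P.map (X i) = F)
    (hindep : iIndepFun X P) : IsPairwiseSample P F X :=
  ⟨hX, hlaw, fun _ _ hij => hindep.indepFun hij⟩

theorem measurePreserving_tuple (hX : ∀ i, Measurable (X i)) (hlaw : ∀ i, P.map (X i) = F)
    (hindep : iIndepFun X P) {k : ℕ} {σ : Fin k → ℕ} (hσ : Function.Injective σ) :
    MeasurePreserving (fun ω l => X (σ l) ω) P (Measure.pi fun _ : Fin k => F) := by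
  refine ⟨measurable_pi_lambda _ fun l => hX (σ l), ?_⟩
  have := (hindep.precomp hσ).map_fun_eq_pi_map fun l => (hX (σ l)).aemeasurable
  simpa [hlaw] using this

/-- Distinct blocks use disjoint indices, since division by k recovers the number of the block. The
weak law then applies to functions of k observations. -/
theorem isPairwiseSample_blocks (hX : ∀ i, Measurable (X i)) (hlaw : ∀ i, P.map (X i) = F)
    (hindep : iIndepFun X P) (k : ℕ) :
    IsPairwiseSample P (Measure.pi fun _ : Fin k => F)
      fun c ω (l : Fin k) => X (c * k + l) ω := by
  have hinj : ∀ c, Function.Injective fun l : Fin k => c * k + (l : ℕ) := fun c l l' h =>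
    Fin.ext (Nat.add_left_cancel h)
  refine ⟨fun c => (measurePreserving_tuple hX hlaw hindep (hinj c)).measurable,
    fun c => (measurePreserving_tuple hX hlaw hindep (hinj c)).map_eq, fun c c' hcc => ?_⟩
  have hdisj : Disjoint (Finset.univ.image fun l : Fin k => c * k + (l : ℕ))
      (Finset.univ.image fun l : Fin k => c' * k + (l : ℕ)) := by
    rw [Finset.disjoint_left]
    rintro a ha hb
    simp only [Finset.mem_image, Finset.mem_univ, true_and] at ha hb
    obtain ⟨l, rfl⟩ := ha
    obtain ⟨l', hl'⟩ := hb
    have h1 : (c * k + l : ℕ) / k = c := by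
      rw [Nat.mul_comm, Nat.mul_add_div (l.pos), Nat.div_eq_of_lt l.2, add_zero]
    have h2 : (c' * k + l' : ℕ) / k = c' := by
      rw [Nat.mul_comm, Nat.mul_add_div (l'.pos), Nat.div_eq_of_lt l'.2, add_zero]
    exact hcc (by rw [← h1, ← h2, hl'])
  have hind := hindep.indepFun_finset _ _ hdisj hX
  exact hind.comp
    (φ := fun y (l : Fin k) => y ⟨c * k + l, Finset.mem_image_of_mem _ (Finset.mem_univ l)⟩)
    (ψ := fun y (l : Fin k) => y ⟨c' * k + l, Finset.mem_image_of_mem _ (Finset.mem_univ l)⟩)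
    (by fun_prop) (by fun_prop)

end Tuples

/-! ### Wald's consistency argument -/

section Consistency

variable {S : Type*} [MeasurableSpace S] {Ω : Type*} [MeasurableSpace Ω] {P : Measure Ω}
  [IsProbabilityMeasure P] {F : Measure S} {X : ℕ → Ω → S} {E : Type*}

omit [IsProbabilityMeasure P] in
-- The law of the tuple does not depend on m, so the mean of |g| / m is a constant over m.
theorem withHighProb_window (hX : ∀ i, Measurable (X i)) (hlaw : ∀ i, P.map (X i) = F)
    (hindep : iIndepFun X P) {k : ℕ} {σ : ℕ → Fin k → ℕ} (hσ : ∀ m, Function.Injective (σ m))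
    {g : (Fin k → S) → ℝ} (hg : Integrable g (Measure.pi fun _ => F)) {ε : ℝ} (hε : 0 < ε) :
    WithHighProb P fun m ω => |g fun l => X (σ m l) ω| / m < ε := by
  have hmp := fun m => measurePreserving_tuple hX hlaw hindep (hσ m)
  refine WithHighProb.of_integral_tendsto
    (fun m => ((hmp m).integrable_comp_of_integrable hg).abs.div_const _)
    (fun m ω => by positivity) ?_ hε
  have : ∀ m, ∫ ω, |g fun l => X (σ m l) ω| / m ∂P
      = (∫ x, |g x| ∂(Measure.pi fun _ : Fin k => F)) / m := fun m => by
    rw [integral_div]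
    congr 1
    rw [← (hmp m).map_eq, integral_map (hmp m).measurable.aemeasurable]
    rw [(hmp m).map_eq]
    exact hg.abs.aestronglyMeasurable
  exact (tendsto_const_div_atTop_nhds_zero_nat _).congr fun m => (this m).symm

/-- Wald's argument: parameters whose log likelihood ratio against `θ₀` for `k` observations is
dominated by a function with negative mean are eventually less likely than `θ₀`. -/
theorem withHighProb_prod_lt (hX : ∀ i, Measurable (X i)) (hlaw : ∀ i, P.map (X i) = F)
    (hindep : iIndepFun X P) {f : E → S → ℝ} {T : Set E} {θ₀ : E}
    (hnn : ∀ θ ∈ T, ∀ x, 0 ≤ f θ x) (hpos : ∀ᵐ x ∂F, 0 < f θ₀ x) {k : ℕ}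
    {g : (Fin k → S) → ℝ} (hg : Integrable g (Measure.pi fun _ => F))
    (hneg : ∫ x, g x ∂(Measure.pi fun _ => F) < 0)
    (hdom : ∀ᵐ x ∂(Measure.pi fun _ => F), ∀ θ ∈ T,
      ∏ i, f θ (x i) ≤ Real.exp (g x) * ∏ i, f θ₀ (x i)) :
    WithHighProb P fun m ω => ∀ θ ∈ T,
      ∏ i ∈ Finset.range m, f θ (X i ω) < ∏ i ∈ Finset.range m, f θ₀ (X i ω) := by
  have hsamp := IsPairwiseSample.of_iIndepFun hX hlaw hindep
  have hprob : IsProbabilityMeasure F :=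
    hlaw 0 ▸ Measure.isProbabilityMeasure_map (hX 0).aemeasurable
  set μ := ∫ x, g x ∂(Measure.pi fun _ => F) with hμ
  rcases Nat.eq_zero_or_pos k with rfl | hk
  · have hT : T = ∅ := by
      obtain ⟨x, hx⟩ := hdom.exists
      refine Set.eq_empty_of_forall_notMem fun θ hθ => ?_
      have h1 := hx θ hθ
      have h2 : μ = g x := by
        rw [hμ, show g = fun _ => g x from funext fun y => congrArg g (Subsingleton.elim y x)]
        simp
      rw [h2] at hneg
      simp only [Finset.univ_eq_empty, Finset.prod_empty, mul_one] at h1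
      exact absurd h1 (not_le.2 (Real.exp_lt_one_iff.2 hneg))
    exact .of_ae fun m => by simp [hT]
  -- One block fewer than fits, so that k ≤ s m < 2k. The domination concerns exactly k distinct
  -- observations, so the leftover ones are covered by cyclic windows of length k, each being used k
  -- times; the k-th power of the likelihood accounts for this.
  set q : ℕ → ℕ := fun m => m / k - 1 with hq
  set s : ℕ → ℕ := fun m => m - q m * k with hs
  have hqs : ∀ m, k ≤ m → q m * k + s m = m ∧ k ≤ s m ∧ s m < 2 * k := fun m hm => by
    have h1 : 1 ≤ m / k := (Nat.one_le_div_iff hk).2 hm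
    obtain ⟨t, ht⟩ : ∃ t, m / k = t + 1 := ⟨m / k - 1, by omega⟩
    have h2 := Nat.div_add_mod m k
    have h3 := Nat.mod_lt m hk
    have h4 : q m = t := by simp [hq, ht]
    have h5 : s m = m - t * k := by simp [hs, h4]
    rw [ht, Nat.mul_comm, Nat.succ_mul] at h2
    rw [h4]
    omega
  have hqt : Tendsto q atTop atTop :=
    (tendsto_sub_atTop_nat 1).comp (Nat.tendsto_div_const_atTop hk.ne')
  -- For m ≥ 4k the blocks give k A ≤ μ m / 4, and the fewer than 2k windows give D ≤ 2 k ε m = -μ m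
  -- / 8, so the total is negative.
  set ε : ℝ := -μ / (16 * k) with hε
  have hk0 : (0 : ℝ) < k := by exact_mod_cast hk
  have hε0 : 0 < ε := div_pos (by linarith) (by positivity)
  have hB : WithHighProb P fun m ω =>
      |(∑ c ∈ Finset.range (q m), g fun l : Fin k => X (c * k + l) ω) / (q m : ℕ) - μ|
        < -μ / 2 := by
    have := (isPairwiseSample_blocks hX hlaw hindep k).withHighProb_mean hg
      (show 0 < -μ / 2 by linarith)
    exact this.comp_tendsto hqt
  -- The range 2k bounds the number of windows for every m ≥ k, and `max k (s m)` keeps them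
  -- injective for small m as well.
  have hwin : ∀ j ∈ Finset.range (2 * k), WithHighProb P fun m ω =>
      |g fun l : Fin k => X (q m * k + (j + l) % max k (s m)) ω| / m < ε := fun j _ =>
    withHighProb_window hX hlaw hindep
      (fun m => injective_cyclic_window (q m * k) j (le_max_left k (s m))) hg hε0
  have hdomX : ∀ᵐ ω ∂P, ∀ σ : Fin k → ℕ, Function.Injective σ → ∀ θ ∈ T,
      ∏ i, f θ (X (σ i) ω) ≤ Real.exp (g fun l => X (σ l) ω) * ∏ i, f θ₀ (X (σ i) ω) := by
    refine ae_all_iff.2 fun σ => ?_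
    by_cases hσ : Function.Injective σ
    · filter_upwards [(measurePreserving_tuple hX hlaw hindep hσ).quasiMeasurePreserving.ae
        hdom] with ω hω _
      exact hω
    · exact Eventually.of_forall fun ω h => absurd h hσ
  refine ((hB.and (WithHighProb.finset_all _ hwin)).and
    ((WithHighProb.of_ae fun _ => hdomX).and (.of_ae fun _ => hsamp.ae_all hpos))).mono ?_
  filter_upwards [eventually_ge_atTop (4 * k)] with m hm ω
  rintro ⟨⟨h1, h2⟩, h3, h4⟩ θ hθ
  obtain ⟨e1, e2, e3⟩ := hqs m (by omega)
  rw [max_eq_right e2] at h2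
  have hprod0 : ∀ a : Finset ℕ, 0 < ∏ i ∈ a, f θ₀ (X i ω) := fun a =>
    Finset.prod_pos fun i _ => h4 i
  have hm0 : (0 : ℝ) < m := by exact_mod_cast (by omega : 0 < m)
  have hq0 : 0 < q m := by
    by_contra h0
    have : q m = 0 := by omega
    rw [this] at e1
    omega
  set A := ∑ c ∈ Finset.range (q m), g fun l : Fin k => X (c * k + l) ω with hA
  set D := ∑ j ∈ Finset.range (s m), g fun l : Fin k => X (q m * k + (j + l) % s m) ω with hD
  have hAle : A ≤ q m * (μ / 2) := by
    have := (abs_lt.1 h1).2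
    have hq0' : (0 : ℝ) < q m := by exact_mod_cast hq0
    have h5 : A / q m < μ / 2 := by linarith
    rw [div_lt_iff₀ hq0'] at h5
    linarith
  have hDle : D ≤ 2 * k * (ε * m) := by
    calc D ≤ ∑ j ∈ Finset.range (s m), ε * m := by
          refine Finset.sum_le_sum fun j hj => ?_
          have := h2 j (Finset.mem_range.2 ((Finset.mem_range.1 hj).trans e3))
          rw [div_lt_iff₀ hm0] at this
          exact (le_abs_self _).trans this.le
      _ = s m * (ε * m) := by simp
      _ ≤ 2 * k * (ε * m) := by
          have : (s m : ℝ) ≤ 2 * k := by exact_mod_cast e3.le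
          gcongr
  have hexp : k * A + D < 0 := by
    have hqm : (m : ℝ) ≤ 2 * (q m * k) := by
      exact_mod_cast (by omega : m ≤ 2 * (q m * k))
    have h6 : 2 * k * (ε * m) = -μ / 8 * m := by
      rw [hε]
      field_simp
      ring
    have h7 : k * A ≤ k * (q m * (μ / 2)) := by gcongr
    nlinarith
  have hpow : (∏ i ∈ Finset.range m, f θ (X i ω)) ^ k
      ≤ Real.exp (k * A + D) * (∏ i ∈ Finset.range m, f θ₀ (X i ω)) ^ k := by
    rw [← e1, prod_range_pow_eq, prod_range_pow_eq, Real.exp_add, Real.exp_nat_mul, hA, hD,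
      Real.exp_sum, Real.exp_sum, mul_mul_mul_comm, ← mul_pow, ← Finset.prod_mul_distrib,
      ← Finset.prod_mul_distrib]
    have hp : ∀ σ : Fin k → ℕ, 0 ≤ ∏ l, f θ (X (σ l) ω) := fun σ =>
      Finset.prod_nonneg fun l _ => hnn θ hθ _
    have hr : ∀ σ : Fin k → ℕ, 0 ≤ Real.exp (g fun l => X (σ l) ω) * ∏ l, f θ₀ (X (σ l) ω) :=
      fun σ => mul_nonneg (Real.exp_pos _).le (Finset.prod_nonneg fun l _ => (h4 _).le)
    refine mul_le_mul (pow_le_pow_left₀ (Finset.prod_nonneg fun c _ => hp fun l => c * k + l)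
      (Finset.prod_le_prod (fun c _ => hp fun l => c * k + l) fun c _ =>
        h3 (fun l => c * k + l) (fun l l' h => Fin.ext (Nat.add_left_cancel h)) θ hθ) k)
      (Finset.prod_le_prod (fun j _ => hp fun l => q m * k + (j + l) % s m) fun j _ =>
        h3 _ (injective_cyclic_window (q m * k) j e2) θ hθ)
      (Finset.prod_nonneg fun j _ => hp fun l => q m * k + (j + l) % s m)
      (pow_nonneg (Finset.prod_nonneg fun c _ => hr fun l => c * k + l) k)
  refine lt_of_pow_lt_pow_left₀ k (hprod0 _).le (hpow.trans_lt ?_)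
  exact mul_lt_of_lt_one_left (pow_pos (hprod0 _) k) (Real.exp_lt_one_iff.2 hexp)

end Consistency

/-! ### Consistency of the maximum likelihood estimator -/

section MLE

variable {S : Type*} [MeasurableSpace S] {Ω : Type*} [MeasurableSpace Ω] {P : Measure Ω}
  [IsProbabilityMeasure P] {X : ℕ → Ω → S} {p : ℕ}

/-- Consistency of the maximum likelihood estimator. -/
theorem WaldSeparatedAt.withHighProb_dist_lt {lam : Measure S}
    {Θ : Set (EuclideanSpace ℝ (Fin p))} {f : EuclideanSpace ℝ (Fin p) → S → ℝ}
    {θ₀ : EuclideanSpace ℝ (Fin p)} (hsep : WaldSeparatedAt lam Θ f θ₀)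
    (hf : IsDensityFamily lam Θ f) (hθ₀ : θ₀ ∈ Θ)
    (hX : ∀ i, Measurable (X i)) (hlaw : ∀ i, P.map (X i) = model lam f θ₀)
    (hindep : iIndepFun X P) {θhat : (m : ℕ) → (Fin m → S) → EuclideanSpace ℝ (Fin p)}
    (hmle : WithHighProb P fun m ω => IsMLE Θ f (fun i : Fin m => X i ω)
      (θhat m (fun i : Fin m => X i ω))) {ε : ℝ} (hε : 0 < ε) :
    WithHighProb P fun m ω => dist (θhat m (fun i : Fin m => X i ω)) θ₀ < ε := by
  have := hf.isProbabilityMeasure θ₀ hθ₀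
  obtain ⟨k, r, U, hcov, hU⟩ := hsep ε hε
  have hall : WithHighProb P fun m ω => ∀ j ∈ (Finset.univ : Finset (Fin r)), ∀ θ ∈ Θ ∩ U j,
      ∏ i ∈ Finset.range m, f θ (X i ω) < ∏ i ∈ Finset.range m, f θ₀ (X i ω) := by
    refine WithHighProb.finset_all _ fun j _ => ?_
    obtain ⟨g, hg, hneg, hdom⟩ := hU j
    exact withHighProb_prod_lt hX hlaw hindep (fun θ hθ => hf.nonneg θ hθ.1)
      (ae_pos_of_model lam f θ₀ (hf.measurable θ₀ hθ₀)) hg hneg hdom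
  refine (hmle.and hall).mono (Eventually.of_forall fun m ω => ?_)
  rintro ⟨⟨hmem, hmax⟩, hlt⟩
  by_contra hcon
  obtain ⟨j, hj⟩ := hcov _ hmem (not_lt.1 hcon)
  have h1 := hlt j (Finset.mem_univ _) _ ⟨hmem, hj⟩
  have h2 := hmax θ₀ hθ₀
  rw [Fin.prod_univ_eq_prod_range (fun i => f θ₀ (X i ω)) m,
    Fin.prod_univ_eq_prod_range (fun i => f (θhat m fun i : Fin m => X i ω) (X i ω)) m] at h2
  exact absurd h1 (not_lt.2 h2)

end MLE

/-! ### Kernels as bilinear forms on densities -/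

section KernelForm

variable {S : Type*} [MeasurableSpace S] {F : Measure S} [SFinite F] {k : S → S → ℝ} {C : ℝ}

/-- The bilinear form `∬ k(s,t) φ(s) ψ(t) dF(s) dF(t)`. -/
noncomputable def kernelForm (F : Measure S) (k : S → S → ℝ) (φ ψ : S → ℝ) : ℝ :=
  ∫ z, k z.1 z.2 * (φ z.1 * ψ z.2) ∂(F.prod F)

omit [SFinite F] in
theorem integrable_kernel_mul (hk : Measurable (Function.uncurry k)) (hC : ∀ s t, |k s t| ≤ C)
    {φ ψ : S → ℝ} (hφ : Integrable φ F) (hψ : Integrable ψ F) :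
    Integrable (fun z : S × S => k z.1 z.2 * (φ z.1 * ψ z.2)) (F.prod F) :=
  (hφ.mul_prod hψ).bdd_mul (c := C) hk.aestronglyMeasurable
    (Eventually.of_forall fun z => hC z.1 z.2)

theorem kernelForm_eq_iterated (hk : Measurable (Function.uncurry k)) (hC : ∀ s t, |k s t| ≤ C)
    {φ ψ : S → ℝ} (hφ : Integrable φ F) (hψ : Integrable ψ F) :
    kernelForm F k φ ψ = ∫ s, ∫ t, k s t * (φ s * ψ t) ∂F ∂F :=
  integral_prod _ (integrable_kernel_mul hk hC hφ hψ)

omit [SFinite F] in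
theorem kernelForm_add_left (hk : Measurable (Function.uncurry k)) (hC : ∀ s t, |k s t| ≤ C)
    {φ φ' ψ : S → ℝ} (hφ : Integrable φ F) (hφ' : Integrable φ' F) (hψ : Integrable ψ F) :
    kernelForm F k (fun x => φ x + φ' x) ψ = kernelForm F k φ ψ + kernelForm F k φ' ψ := by
  simp only [kernelForm]
  rw [← integral_add (integrable_kernel_mul hk hC hφ hψ) (integrable_kernel_mul hk hC hφ' hψ)]
  congr with z
  ring

omit [SFinite F] in
theorem kernelForm_add_right (hk : Measurable (Function.uncurry k)) (hC : ∀ s t, |k s t| ≤ C)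
    {φ ψ ψ' : S → ℝ} (hφ : Integrable φ F) (hψ : Integrable ψ F) (hψ' : Integrable ψ' F) :
    kernelForm F k φ (fun x => ψ x + ψ' x) = kernelForm F k φ ψ + kernelForm F k φ ψ' := by
  simp only [kernelForm]
  rw [← integral_add (integrable_kernel_mul hk hC hφ hψ) (integrable_kernel_mul hk hC hφ hψ')]
  congr with z
  ring

omit [SFinite F] in
theorem kernelForm_smul_left (c : ℝ) (φ ψ : S → ℝ) :
    kernelForm F k (fun x => c * φ x) ψ = c * kernelForm F k φ ψ := by
  simp only [kernelForm]
  rw [← integral_const_mul]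
  congr with z
  ring

omit [SFinite F] in
theorem kernelForm_smul_right (c : ℝ) (φ ψ : S → ℝ) :
    kernelForm F k φ (fun x => c * ψ x) = c * kernelForm F k φ ψ := by
  simp only [kernelForm]
  rw [← integral_const_mul]
  congr with z
  ring

theorem abs_kernelForm_le (hC : ∀ s t, |k s t| ≤ C) {φ ψ : S → ℝ}
    (hφ : Integrable φ F) (hψ : Integrable ψ F) :
    |kernelForm F k φ ψ| ≤ C * ((∫ x, |φ x| ∂F) * ∫ x, |ψ x| ∂F) := by
  rw [← integral_prod_mul, ← integral_const_mul, ← Real.norm_eq_abs]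
  refine norm_integral_le_of_norm_le ((hφ.abs.mul_prod hψ.abs).const_mul C)
    (Eventually.of_forall fun z => ?_)
  rw [Real.norm_eq_abs, abs_mul, abs_mul]
  have := hC z.1 z.2
  gcongr

theorem biInt_withDensity (hk : Measurable (Function.uncurry k)) (hC : ∀ s t, |k s t| ≤ C)
    {φ ψ : S → ℝ} (hφ : Integrable φ F) (hψ : Integrable ψ F) (hφm : Measurable φ)
    (hψm : Measurable ψ) (hφ0 : ∀ᵐ x ∂F, 0 ≤ φ x) (hψ0 : ∀ᵐ x ∂F, 0 ≤ ψ x) :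
    biInt k (F.withDensity fun x => ENNReal.ofReal (φ x))
      (F.withDensity fun x => ENNReal.ofReal (ψ x)) = kernelForm F k φ ψ := by
  have key : ∀ {ξ : S → ℝ}, Measurable ξ → (∀ᵐ x ∂F, 0 ≤ ξ x) → ∀ g : S → ℝ,
      ∫ x, g x ∂(F.withDensity fun x => ENNReal.ofReal (ξ x)) = ∫ x, ξ x * g x ∂F := by
    intro ξ hm h0 g
    rw [integral_withDensity_eq_integral_toReal_smul (by fun_prop) (by simp)]
    refine integral_congr_ae (h0.mono fun x hx => ?_)
    simp [ENNReal.toReal_ofReal hx]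
  rw [biInt, key hφm hφ0, kernelForm_eq_iterated hk hC hφ hψ]
  congr with s
  rw [key hψm hψ0, ← integral_const_mul]
  congr with t
  ring

/-- F has density 1 with respect to itself, so all four double integrals are values of one bilinear
form at 1 and φ, and they collapse to its value at φ - 1. -/
theorem quadForm_withDensity [IsFiniteMeasure F] (hk : Measurable (Function.uncurry k))
    (hC : ∀ s t, |k s t| ≤ C) {φ : S → ℝ} (hφ : Integrable φ F) (hφm : Measurable φ)
    (hφ0 : ∀ᵐ x ∂F, 0 ≤ φ x) :
    quadForm k F (F.withDensity fun x => ENNReal.ofReal (φ x))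
      = kernelForm F k (fun x => φ x - 1) fun x => φ x - 1 := by
  have h1 : F = F.withDensity fun _ => ENNReal.ofReal 1 := by simp
  have hi1 : Integrable (fun _ : S => (1 : ℝ)) F := integrable_const _
  have hi2 : Integrable (fun _ : S => (-1 : ℝ)) F := integrable_const _
  have hn : ∀ᵐ x : S ∂F, (0 : ℝ) ≤ 1 := Eventually.of_forall fun _ => zero_le_one
  have e11 : biInt k F F = kernelForm F k (fun _ => 1) fun _ => 1 := by
    conv_lhs => rw [h1]
    exact biInt_withDensity hk hC hi1 hi1 measurable_const measurable_const hn hn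
  have e12 : biInt k F (F.withDensity fun x => ENNReal.ofReal (φ x))
      = kernelForm F k (fun _ => 1) φ := by
    conv_lhs => arg 2; rw [h1]
    exact biInt_withDensity hk hC hi1 hφ measurable_const hφm hn hφ0
  have e21 : biInt k (F.withDensity fun x => ENNReal.ofReal (φ x)) F
      = kernelForm F k φ fun _ => 1 := by
    conv_lhs => arg 3; rw [h1]
    exact biInt_withDensity hk hC hφ hi1 hφm measurable_const hφ0 hn
  have c1 : ∀ ψ : S → ℝ, kernelForm F k (fun _ => -1) ψ = - kernelForm F k (fun _ => 1) ψ :=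
    fun ψ => by simpa using kernelForm_smul_left (F := F) (k := k) (-1) (fun _ => 1) ψ
  have c2 : ∀ ψ : S → ℝ, kernelForm F k ψ (fun _ => -1) = - kernelForm F k ψ (fun _ => 1) :=
    fun ψ => by simpa using kernelForm_smul_right (F := F) (k := k) (-1) ψ (fun _ => 1)
  rw [quadForm, e11, e12, e21, biInt_withDensity hk hC hφ hφ hφm hφm hφ0 hφ0]
  simp only [sub_eq_add_neg]
  have hsum : Integrable (fun x => φ x + -1) F := hφ.add hi2
  rw [kernelForm_add_left hk hC hφ hi2 hsum, kernelForm_add_right hk hC hφ hφ hi2,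
    kernelForm_add_right hk hC hi2 hφ hi2, c1, c1, c2, c2]
  ring

end KernelForm

/-! ### Second order expansion of the distance -/

section Distance

variable {S : Type*} [MeasurableSpace S] {E : Type*} [NormedAddCommGroup E]
  [InnerProductSpace ℝ E] {F : Measure S} [IsProbabilityMeasure F] {θ₀ : E} {L : E → S → ℝ}
  {u : S → E} {W : S → E →L[ℝ] E →L[ℝ] ℝ} {ρ : ℝ} {h H : S → ℝ}

/-- Second order expansion of the quadratic distance between `F` and a nearby model element. -/
theorem LikelihoodExpansion.quadForm_isLittleO (hE : LikelihoodExpansion F θ₀ L u W ρ h H)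
    {k : E → S → S → ℝ} {k₀ : S → S → ℝ} {C : ℝ}
    (hk : ∀ᶠ θ in 𝓝 θ₀, Measurable (Function.uncurry (k θ)))
    (hk₀ : Measurable (Function.uncurry k₀)) (hC : ∀ᶠ θ in 𝓝 θ₀, ∀ s t, |k θ s t| ≤ C)
    (hC₀ : ∀ s t, |k₀ s t| ≤ C)
    (hlim : ∀ᵐ z ∂(F.prod F), Tendsto (fun θ => k θ z.1 z.2) (𝓝 θ₀) (𝓝 (k₀ z.1 z.2))) :
    (fun θ => quadForm (k θ) F (F.withDensity fun x => ENNReal.ofReal (L θ x))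
      - kernelForm F k₀ (fun x => inner ℝ (u x) (θ - θ₀)) fun x => inner ℝ (u x) (θ - θ₀))
      =o[𝓝 θ₀] fun θ => ‖θ - θ₀‖ ^ 2 := by
  set Ih := ∫ x, h x ∂F with hIh
  set Iu := ∫ x, ‖u x‖ ∂F with hIu
  -- D θ ‖θ - θ₀‖² bounds the cost of replacing the kernel at θ by k₀ in the leading term. It
  -- vanishes by dominated convergence.
  set D : E → ℝ := fun θ => ∫ z, |k θ z.1 z.2 - k₀ z.1 z.2| * (‖u z.1‖ * ‖u z.2‖) ∂(F.prod F)
    with hD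
  have huu : Integrable (fun z : S × S => ‖u z.1‖ * ‖u z.2‖) (F.prod F) :=
    hE.integrable_score.norm.mul_prod hE.integrable_score.norm
  have hDlim : Tendsto D (𝓝 θ₀) (𝓝 0) := by
    have := tendsto_integral_filter_of_dominated_convergence (μ := F.prod F) (l := 𝓝 θ₀)
      (F := fun θ z => |k θ z.1 z.2 - k₀ z.1 z.2| * (‖u z.1‖ * ‖u z.2‖)) (f := fun _ => 0)
      (fun z => 2 * C * (‖u z.1‖ * ‖u z.2‖))
      (by
        filter_upwards [hk] with θ hθ
        exact (continuous_abs.comp_aestronglyMeasurable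
          (hθ.sub hk₀).aestronglyMeasurable).mul huu.aestronglyMeasurable)
      (by
        filter_upwards [hC] with θ hθ
        refine Eventually.of_forall fun z => ?_
        rw [Real.norm_of_nonneg (by positivity)]
        have h1 := abs_sub (k θ z.1 z.2) (k₀ z.1 z.2)
        have h2 := hθ z.1 z.2
        have h3 := hC₀ z.1 z.2
        have h4 : |k θ z.1 z.2 - k₀ z.1 z.2| ≤ 2 * C := by linarith
        gcongr)
      (huu.const_mul _)
      (by
        filter_upwards [hlim] with z hz
        have := ((hz.sub_const (k₀ z.1 z.2)).abs.mul_const (‖u z.1‖ * ‖u z.2‖))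
        simpa using this)
    simpa using this
  have hnorm : Tendsto (fun θ => ‖θ - θ₀‖) (𝓝 θ₀) (𝓝 0) := by
    have : Continuous fun θ => ‖θ - θ₀‖ := by fun_prop
    simpa using this.tendsto θ₀
  -- After division by ‖θ - θ₀‖²: the two cross terms of linear part and remainder, the remainder
  -- against itself, and the kernel replacement.
  set e : E → ℝ := fun θ => C * (2 * Iu * Ih * ‖θ - θ₀‖ + Ih ^ 2 * ‖θ - θ₀‖ ^ 2) + D θ with he
  have helim : Tendsto e (𝓝 θ₀) (𝓝 0) := by
    have := (((hnorm.const_mul (2 * Iu * Ih)).add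
      ((hnorm.pow 2).const_mul (Ih ^ 2))).const_mul C).add hDlim
    simpa using this
  rw [Asymptotics.isLittleO_iff]
  intro c hc
  filter_upwards [hk, hC, helim.eventually_le_const hc,
    Metric.ball_mem_nhds θ₀ hE.radius_pos] with θ hkθ hCθ heθ hθ
  set v := θ - θ₀ with hv
  set ℓ : S → ℝ := fun x => inner ℝ (u x) v with hℓ
  set r : S → ℝ := fun x => L θ x - 1 - inner ℝ (u x) v with hr
  have hℓi : Integrable ℓ F := hE.integrable_inner v
  have hLi := hE.integrable_ratio hθ
  have hri : Integrable r F := (hLi.sub (integrable_const _)).sub hℓi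
  obtain ⟨x₀⟩ := nonempty_of_isProbabilityMeasure F
  have hC0 : 0 ≤ C := (abs_nonneg _).trans (hC₀ x₀ x₀)
  have hIu0 : 0 ≤ Iu := integral_nonneg fun x => norm_nonneg _
  have hrn : ∫ x, |r x| ∂F ≤ Ih * ‖v‖ ^ 2 := by
    rw [hIh, ← integral_mul_const]
    refine integral_mono_ae hri.abs (hE.integrable_h.mul_const _) ?_
    filter_upwards [hE.abs_sub_le] with x hx using hx θ hθ
  have hℓn : ∫ x, |ℓ x| ∂F ≤ Iu * ‖v‖ := by
    rw [hIu, ← integral_mul_const]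
    exact integral_mono hℓi.abs (hE.integrable_score.norm.mul_const _)
      fun x => abs_real_inner_le_norm _ _
  have hr0 : 0 ≤ ∫ x, |r x| ∂F := integral_nonneg fun x => abs_nonneg _
  have hℓ0 : 0 ≤ ∫ x, |ℓ x| ∂F := integral_nonneg fun x => abs_nonneg _
  have hsplit : (fun x => L θ x - 1) = fun x => ℓ x + r x := by
    funext x
    simp only [hℓ, hr]
    ring
  have hsum : Integrable (fun x => ℓ x + r x) F := hℓi.add hri
  have hform : quadForm (k θ) F (F.withDensity fun x => ENNReal.ofReal (L θ x))
      = kernelForm F (k θ) ℓ ℓ + kernelForm F (k θ) ℓ r + kernelForm F (k θ) r ℓ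
        + kernelForm F (k θ) r r := by
    rw [quadForm_withDensity hkθ hCθ hLi (hE.measurable θ hθ)
      (hE.pos.mono fun x hx => (hx θ hθ).le), hsplit,
      kernelForm_add_left hkθ hCθ hℓi hri hsum, kernelForm_add_right hkθ hCθ hℓi hℓi hri,
      kernelForm_add_right hkθ hCθ hri hℓi hri]
    ring
  have hdiff : |kernelForm F (k θ) ℓ ℓ - kernelForm F k₀ ℓ ℓ| ≤ D θ * ‖v‖ ^ 2 := by
    simp only [kernelForm, hD]
    rw [← integral_sub (integrable_kernel_mul hkθ hCθ hℓi hℓi)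
      (integrable_kernel_mul hk₀ hC₀ hℓi hℓi), ← integral_mul_const, ← Real.norm_eq_abs]
    refine norm_integral_le_of_norm_le ?_ (Eventually.of_forall fun z => ?_)
    · refine Integrable.mul_const ?_ _
      refine huu.bdd_mul (c := 2 * C) (continuous_abs.comp_aestronglyMeasurable
          (hkθ.sub hk₀).aestronglyMeasurable) (Eventually.of_forall fun z => ?_)
      have h1 := abs_sub (k θ z.1 z.2) (k₀ z.1 z.2)
      have h2 := hCθ z.1 z.2
      have h3 := hC₀ z.1 z.2
      simp only [norm_abs_eq_norm, Real.norm_eq_abs]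
      linarith
    · rw [← sub_mul, Real.norm_eq_abs, abs_mul, abs_mul]
      have h1 : |ℓ z.1| ≤ ‖u z.1‖ * ‖v‖ := abs_real_inner_le_norm _ _
      have h2 : |ℓ z.2| ≤ ‖u z.2‖ * ‖v‖ := abs_real_inner_le_norm _ _
      calc _ ≤ |k θ z.1 z.2 - k₀ z.1 z.2| * ((‖u z.1‖ * ‖v‖) * (‖u z.2‖ * ‖v‖)) := by gcongr
        _ = _ := by ring
  have hb1 := abs_kernelForm_le hCθ hℓi hri
  have hb2 := abs_kernelForm_le hCθ hri hℓi
  have hb3 := abs_kernelForm_le hCθ hri hri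
  have hc1 : (∫ x, |ℓ x| ∂F) * ∫ x, |r x| ∂F ≤ (Iu * ‖v‖) * (Ih * ‖v‖ ^ 2) := by gcongr
  have hc3 : (∫ x, |r x| ∂F) * ∫ x, |r x| ∂F ≤ (Ih * ‖v‖ ^ 2) * (Ih * ‖v‖ ^ 2) :=
    mul_le_mul hrn hrn hr0 (hr0.trans hrn)
  have hd1 := hb1.trans (mul_le_mul_of_nonneg_left hc1 hC0)
  have hd2 := hb2.trans (mul_le_mul_of_nonneg_left ((mul_comm _ _).trans_le hc1) hC0)
  have hd3 := hb3.trans (mul_le_mul_of_nonneg_left hc3 hC0)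
  rw [Real.norm_eq_abs, Real.norm_of_nonneg (sq_nonneg ‖v‖), hform]
  have htot : |kernelForm F (k θ) ℓ ℓ + kernelForm F (k θ) ℓ r + kernelForm F (k θ) r ℓ
        + kernelForm F (k θ) r r - kernelForm F k₀ ℓ ℓ| ≤ e θ * ‖v‖ ^ 2 := by
    have heq : e θ * ‖v‖ ^ 2 = D θ * ‖v‖ ^ 2 + C * ((Iu * ‖v‖) * (Ih * ‖v‖ ^ 2))
        + C * ((Iu * ‖v‖) * (Ih * ‖v‖ ^ 2)) + C * ((Ih * ‖v‖ ^ 2) * (Ih * ‖v‖ ^ 2)) := by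
      simp only [he, ← hv]
      ring
    rw [heq]
    rw [abs_le] at hdiff hd1 hd2 hd3 ⊢
    constructor <;> linarith [hdiff.1, hdiff.2, hd1.1, hd1.2, hd2.1, hd2.2, hd3.1, hd3.2]
  exact htot.trans (by gcongr)

end Distance

/-! ### Second moments of sums -/

section SecondMoments

variable {S : Type*} [MeasurableSpace S] {Ω : Type*} [MeasurableSpace Ω] {P : Measure Ω}
  {F : Measure S} {X : ℕ → Ω → S}

theorem IsPairwiseSample.memLp_comp {V : Type*} [NormedAddCommGroup V] {q : ℝ≥0∞}
    (hX : IsPairwiseSample P F X) {φ : S → V}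
    (hφ : MemLp φ q F) (i : ℕ) : MemLp (fun ω => φ (X i ω)) q P :=
  hφ.comp_measurePreserving (hX.measurePreserving i)

/-- Off-diagonal terms factor by independence and vanish as soon as one factor is centered; the m
diagonal terms remain. -/
theorem IsPairwiseSample.integral_sum_mul_sum [IsProbabilityMeasure P]
    (hX : IsPairwiseSample P F X) {φ ψ : S → ℝ} (hφ : MemLp φ 2 F) (hψ : MemLp ψ 2 F)
    (h0 : ∫ x, φ x ∂F = 0) (m : ℕ) :
    Integrable (fun ω => (∑ i ∈ Finset.range m, φ (X i ω)) * ∑ j ∈ Finset.range m, ψ (X j ω)) P ∧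
    ∫ ω, (∑ i ∈ Finset.range m, φ (X i ω)) * ∑ j ∈ Finset.range m, ψ (X j ω) ∂P
      = m * ∫ x, φ x * ψ x ∂F := by
  have hint : ∀ i j, Integrable (fun ω => φ (X i ω) * ψ (X j ω)) P := fun i j =>
    (hX.memLp_comp hφ i).integrable_mul (hX.memLp_comp hψ j)
  simp only [Finset.sum_mul_sum]
  refine ⟨integrable_finsetSum _ fun i _ => integrable_finsetSum _ fun j _ => hint i j, ?_⟩
  rw [integral_finsetSum _ fun i _ => integrable_finsetSum _ fun j _ => hint i j]
  have hterm : ∀ i ∈ Finset.range m,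
      ∫ ω, ∑ j ∈ Finset.range m, φ (X i ω) * ψ (X j ω) ∂P = ∫ x, φ x * ψ x ∂F := by
    intro i hi
    rw [integral_finsetSum _ fun j _ => hint i j, Finset.sum_eq_single_of_mem i hi]
    · exact hX.integral_comp (φ := fun x => φ x * ψ x)
        (hφ.aestronglyMeasurable.mul hψ.aestronglyMeasurable) i
    · intro j _ hji
      rw [IndepFun.integral_fun_mul_eq_mul_integral
        (hX.indepFun_comp hφ.aestronglyMeasurable.aemeasurable
          hψ.aestronglyMeasurable.aemeasurable hji.symm)
        (hX.memLp_comp hφ i).aestronglyMeasurable (hX.memLp_comp hψ j).aestronglyMeasurable,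
        hX.integral_comp hφ.aestronglyMeasurable, h0, zero_mul]
  rw [Finset.sum_congr rfl hterm]
  simp

variable {p : ℕ}

theorem bilin_eq_sum (b : EuclideanSpace ℝ (Fin p) →L[ℝ] EuclideanSpace ℝ (Fin p) →L[ℝ] ℝ)
    (v w : EuclideanSpace ℝ (Fin p)) :
    b v w = ∑ i, ∑ j, v i * w j *
      b (EuclideanSpace.basisFun (Fin p) ℝ i) (EuclideanSpace.basisFun (Fin p) ℝ j) := by
  conv_lhs => rw [← (EuclideanSpace.basisFun (Fin p) ℝ).sum_repr v,
    ← (EuclideanSpace.basisFun (Fin p) ℝ).sum_repr w]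
  simp only [map_sum, map_smul, sum_apply, smul_apply, smul_eq_mul, Finset.mul_sum,
    EuclideanSpace.basisFun_repr]
  rw [Finset.sum_comm]
  exact Finset.sum_congr rfl fun i _ => Finset.sum_congr rfl fun j _ => by ring

theorem memLp_coord {q : ℝ≥0∞} {u : S → EuclideanSpace ℝ (Fin p)} (hu : MemLp u q F) (i : Fin p) :
    MemLp (fun x => u x i) q F :=
  (EuclideanSpace.proj i : EuclideanSpace ℝ (Fin p) →L[ℝ] ℝ).comp_memLp' hu

theorem integrable_bilin {u w : S → EuclideanSpace ℝ (Fin p)} (hu : MemLp u 2 F)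
    (hw : MemLp w 2 F)
    (b : EuclideanSpace ℝ (Fin p) →L[ℝ] EuclideanSpace ℝ (Fin p) →L[ℝ] ℝ) :
    Integrable (fun x => b (u x) (w x)) F := by
  rw [funext fun x => bilin_eq_sum b (u x) (w x)]
  exact integrable_finsetSum _ fun i _ => integrable_finsetSum _ fun j _ =>
    ((memLp_coord hu i).integrable_mul (memLp_coord hw j)).mul_const _

theorem integral_bilin {u w : S → EuclideanSpace ℝ (Fin p)} (hu : MemLp u 2 F)
    (hw : MemLp w 2 F)
    (b : EuclideanSpace ℝ (Fin p) →L[ℝ] EuclideanSpace ℝ (Fin p) →L[ℝ] ℝ) :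
    ∫ x, b (u x) (w x) ∂F = ∑ i, ∑ j, (∫ x, u x i * w x j ∂F) *
      b (EuclideanSpace.basisFun (Fin p) ℝ i) (EuclideanSpace.basisFun (Fin p) ℝ j) := by
  have hint : ∀ i j, Integrable (fun x => u x i * w x j *
      b (EuclideanSpace.basisFun (Fin p) ℝ i) (EuclideanSpace.basisFun (Fin p) ℝ j)) F :=
    fun i j => ((memLp_coord hu i).integrable_mul (memLp_coord hw j)).mul_const _
  rw [funext fun x => bilin_eq_sum b (u x) (w x)]
  rw [integral_finsetSum _ fun i _ => integrable_finsetSum _ fun j _ => hint i j]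
  refine Finset.sum_congr rfl fun i _ => ?_
  rw [integral_finsetSum _ fun j _ => hint i j]
  exact Finset.sum_congr rfl fun j _ => integral_mul_const _ _

theorem IsPairwiseSample.memLp_sum (hX : IsPairwiseSample P F X)
    {u : S → EuclideanSpace ℝ (Fin p)} (hu : MemLp u 2 F) (m : ℕ) :
    MemLp (fun ω => ∑ i ∈ Finset.range m, u (X i ω)) 2 P :=
  memLp_finsetSum _ fun i _ => hX.memLp_comp hu i

theorem IsPairwiseSample.integral_bilin_sum [IsProbabilityMeasure P]
    (hX : IsPairwiseSample P F X) {u : S → EuclideanSpace ℝ (Fin p)} (hu : MemLp u 2 F)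
    (h0 : ∀ i, ∫ x, u x i ∂F = 0)
    (b : EuclideanSpace ℝ (Fin p) →L[ℝ] EuclideanSpace ℝ (Fin p) →L[ℝ] ℝ) (m : ℕ) :
    ∫ ω, b (∑ i ∈ Finset.range m, u (X i ω)) (∑ i ∈ Finset.range m, u (X i ω)) ∂P
      = m * ∫ x, b (u x) (u x) ∂F := by
  rw [integral_bilin (hX.memLp_sum hu m) (hX.memLp_sum hu m), integral_bilin hu hu,
    Finset.mul_sum]
  refine Finset.sum_congr rfl fun i _ => ?_
  rw [Finset.mul_sum]
  refine Finset.sum_congr rfl fun j _ => ?_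
  have := (hX.integral_sum_mul_sum (memLp_coord hu i) (memLp_coord hu j) (h0 i) m).2
  rw [← mul_assoc, ← this]
  simp

end SecondMoments

/-! ### Multivariate central limit theorem -/

section CentralLimit

variable {S : Type*} [MeasurableSpace S] {Ω : Type*} [MeasurableSpace Ω] {P : Measure Ω}
  [IsProbabilityMeasure P] {F : Measure S} {X : ℕ → Ω → S} {p : ℕ}

/-- The matrix of second moments of a random vector. -/
noncomputable def momentMatrix (F : Measure S) (u : S → EuclideanSpace ℝ (Fin p)) :
    Matrix (Fin p) (Fin p) ℝ :=
  Matrix.of fun i j => ∫ x, u x i * u x j ∂F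

theorem momentMatrix_isSymm (F : Measure S) (u : S → EuclideanSpace ℝ (Fin p)) :
    (momentMatrix F u)ᵀ = momentMatrix F u := by
  ext i j
  simp only [momentMatrix, Matrix.transpose_apply, Matrix.of_apply]
  congr with x
  ring

theorem dotProduct_momentMatrix {u : S → EuclideanSpace ℝ (Fin p)} (hu : MemLp u 2 F)
    (v w : EuclideanSpace ℝ (Fin p)) :
    v.ofLp ⬝ᵥ (momentMatrix F u *ᵥ w.ofLp) = ∫ x, inner ℝ (u x) v * inner ℝ (u x) w ∂F := by
  have hint : ∀ i j, Integrable (fun x => v i * w j * (u x i * u x j)) F := fun i j =>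
    ((memLp_coord hu i).integrable_mul (memLp_coord hu j)).const_mul _
  have h1 : ∀ x, inner ℝ (u x) v * inner ℝ (u x) w
      = ∑ i, ∑ j, v i * w j * (u x i * u x j) := fun x => by
    simp only [PiLp.inner_apply, RCLike.inner_apply, conj_trivial, Finset.sum_mul_sum]
    exact Finset.sum_congr rfl fun i _ => Finset.sum_congr rfl fun j _ => by ring
  simp only [h1]
  rw [integral_finsetSum _ fun i _ => integrable_finsetSum _ fun j _ => hint i j]
  simp only [dotProduct, Matrix.mulVec, momentMatrix, Matrix.of_apply, Finset.mul_sum]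
  refine Finset.sum_congr rfl fun i _ => ?_
  rw [integral_finsetSum _ fun j _ => hint i j]
  refine Finset.sum_congr rfl fun j _ => ?_
  rw [integral_const_mul]
  ring

theorem momentMatrix_posSemidef {u : S → EuclideanSpace ℝ (Fin p)} (hu : MemLp u 2 F) :
    (momentMatrix F u).PosSemidef := by
  refine Matrix.PosSemidef.of_dotProduct_mulVec_nonneg ?_ fun v => ?_
  · rw [Matrix.IsHermitian, Matrix.conjTranspose_eq_transpose_of_trivial, momentMatrix_isSymm]
  · have := dotProduct_momentMatrix hu (WithLp.toLp 2 v) (WithLp.toLp 2 v)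
    simp only [star_trivial]
    rw [this]
    exact integral_nonneg fun x => mul_self_nonneg _

omit [IsProbabilityMeasure P] in
-- The Cramér–Wold device: it reduces the vector case to the one-dimensional central limit theorem.
theorem charFun_map_eq_charFun_map_inner {Y : Ω → EuclideanSpace ℝ (Fin p)} (hY : AEMeasurable Y P)
    (t : EuclideanSpace ℝ (Fin p)) :
    charFun (P.map Y) t = charFun (P.map fun ω => inner ℝ (Y ω) t) 1 := by
  have h2 : AEMeasurable (fun ω => inner ℝ (Y ω) t) P := by fun_prop
  rw [charFun_apply, charFun_apply, integral_map hY (by fun_prop), integral_map h2 (by fun_prop)]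
  simp

/-- The multivariate central limit theorem for centered square integrable observations. -/
theorem tendstoInDistribution_multivariateGaussian (hX : ∀ i, Measurable (X i))
    (hlaw : ∀ i, P.map (X i) = F) (hindep : iIndepFun X P)
    {u : S → EuclideanSpace ℝ (Fin p)} (hu : MemLp u 2 F)
    (h0 : ∀ v, ∫ x, inner ℝ (u x) v ∂F = 0) :
    TendstoInDistribution (fun (m : ℕ) ω => (√m)⁻¹ • ∑ i ∈ Finset.range m, u (X i ω)) atTop id
      (fun _ => P) (multivariateGaussian 0 (momentMatrix F u)) := by
  have hsamp := IsPairwiseSample.of_iIndepFun hX hlaw hindep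
  have hmeas : ∀ m : ℕ, AEMeasurable (fun ω => (√m)⁻¹ • ∑ i ∈ Finset.range m, u (X i ω)) P :=
    fun m => ((hsamp.memLp_sum hu m).aestronglyMeasurable.aemeasurable).const_smul (√(m : ℝ))⁻¹
  refine ⟨hmeas, aemeasurable_id, ProbabilityMeasure.tendsto_iff_tendsto_charFun.2 fun t => ?_⟩
  have hφ : MemLp (fun x => inner ℝ (u x) t) 2 F := hu.inner_const t
  have hφm : AEMeasurable (fun x => inner ℝ (u x) t) F := hφ.aestronglyMeasurable.aemeasurable
  set Z : ℕ → Ω → ℝ := fun i ω => inner ℝ (u (X i ω)) t with hZ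
  have hZ0 : MemLp (Z 0) 2 P := hsamp.memLp_comp hφ 0
  have hmean : ∫ ω, Z 0 ω ∂P = 0 := by
    rw [← h0 t]
    exact hsamp.integral_comp hφ.aestronglyMeasurable 0
  have hvar : Var[Z 0; P] = t.ofLp ⬝ᵥ (momentMatrix F u *ᵥ t.ofLp) := by
    rw [variance_of_integral_eq_zero hZ0.aestronglyMeasurable.aemeasurable hmean,
      dotProduct_momentMatrix hu]
    simp only [← sq]
    exact hsamp.integral_comp (φ := fun x => inner ℝ (u x) t ^ 2)
      (hφ.aestronglyMeasurable.pow 2) 0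
  have hclt := tendstoInDistribution_inv_sqrt_mul_sum_sub
    (HasLaw.id (μ := gaussianReal 0 Var[Z 0; P].toNNReal)) hZ0
    (hindep.comp₀ (fun _ x => inner ℝ (u x) t) (fun i => (hX i).aemeasurable)
      fun i => by rwa [hlaw i]) fun i => hsamp.identDistrib_comp hφm i 0
  have hcf := ProbabilityMeasure.tendsto_iff_tendsto_charFun.1 hclt.tendsto 1
  simp only [ProbabilityMeasure.coe_mk, Measure.map_id] at hcf ⊢
  rw [charFun_gaussianReal] at hcf
  rw [charFun_multivariateGaussian (momentMatrix_posSemidef hu)]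
  convert hcf using 1
  · funext m
    rw [charFun_map_eq_charFun_map_inner (hmeas m)]
    congr 2
    funext ω
    rw [hmean]
    simp [hZ, inner_smul_left, sum_inner]
  · rw [Real.coe_toNNReal _ (variance_nonneg _ _), hvar]
    simp

/-- The mean of a quadratic form depends on second moments only, and those of the Gaussian are those
of u. -/
theorem integral_bilin_multivariateGaussian {u : S → EuclideanSpace ℝ (Fin p)} (hu : MemLp u 2 F)
    (b : EuclideanSpace ℝ (Fin p) →L[ℝ] EuclideanSpace ℝ (Fin p) →L[ℝ] ℝ) :
    Integrable (fun x => b x x) (multivariateGaussian 0 (momentMatrix F u)) ∧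
    ∫ x, b x x ∂(multivariateGaussian 0 (momentMatrix F u)) = ∫ x, b (u x) (u x) ∂F := by
  have hid : MemLp (fun x : EuclideanSpace ℝ (Fin p) => x) 2
      (multivariateGaussian 0 (momentMatrix F u)) := IsGaussian.memLp_two_id
  refine ⟨integrable_bilin hid hid b, ?_⟩
  rw [integral_bilin hid hid, integral_bilin hu hu]
  refine Finset.sum_congr rfl fun i _ => Finset.sum_congr rfl fun j _ => ?_
  congr 1
  have hcov := covariance_eval_multivariateGaussian (μ := 0) (momentMatrix_posSemidef hu) i j
  have hmean : ∀ i, ∫ x, x i ∂(multivariateGaussian 0 (momentMatrix F u)) = 0 := fun i => by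
    have h1 := ContinuousLinearMap.integral_comp_comm
      (EuclideanSpace.proj i : EuclideanSpace ℝ (Fin p) →L[ℝ] ℝ) (hid.integrable (by norm_num))
    simpa using h1
  rw [covariance_eq_sub (memLp_coord hid i) (memLp_coord hid j), hmean, zero_mul, sub_zero] at hcov
  exact hcov

end CentralLimit

/-! ### Maximizers of nearly quadratic criteria -/

section Argmax

variable {E : Type*} [NormedAddCommGroup E] [InnerProductSpace ℝ E]

theorem quadratic_eq_sub {T : E →L[ℝ] E} (hT : ∀ v w, inner ℝ (T v) w = inner ℝ v (T w)) (d v : E) :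
    inner ℝ (T d) v - (1 / 2) * inner ℝ v (T v)
      = (1 / 2) * inner ℝ d (T d) - (1 / 2) * inner ℝ (v - d) (T (v - d)) := by
  have h1 : inner ℝ d (T v) = inner ℝ (T d) v := (hT d v).symm
  have h2 : inner ℝ v (T d) = inner ℝ (T d) v := real_inner_comm _ _
  simp only [map_sub, inner_sub_left, inner_sub_right, h1, h2]
  ring

/-- A point at which an approximately quadratic criterion is at least as large as at the maximizer
`d` of the quadratic is close to `d`. -/
theorem norm_sub_sq_le_of_approx_quadratic {T : E →L[ℝ] E}
    (hT : ∀ v w, inner ℝ (T v) w = inner ℝ v (T w)) {c η : ℝ} (hc : 0 < c)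
    (hcT : ∀ v, c * ‖v‖ ^ 2 ≤ inner ℝ v (T v)) (hη0 : 0 ≤ η) (hη : η ≤ c / 8) {ℓ : E → ℝ}
    {d v : E}
    (hd : |ℓ d - inner ℝ (T d) d + (1 / 2) * inner ℝ d (T d)| ≤ η * ‖d‖ ^ 2)
    (hv : |ℓ v - inner ℝ (T d) v + (1 / 2) * inner ℝ v (T v)| ≤ η * ‖v‖ ^ 2)
    (hle : ℓ d ≤ ℓ v) : ‖v - d‖ ^ 2 ≤ 12 * η / c * ‖d‖ ^ 2 := by
  have e1 := quadratic_eq_sub hT d v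
  have e2 := quadratic_eq_sub hT d d
  have e3 := hcT (v - d)
  simp only [sub_self, map_zero, inner_zero_left, mul_zero] at e2
  have h1 := (abs_le.1 hd).1
  have h2 := (abs_le.1 hv).2
  have h3 : ‖v‖ ^ 2 ≤ 2 * ‖v - d‖ ^ 2 + 2 * ‖d‖ ^ 2 := by
    have h4 : ‖v‖ ≤ ‖v - d‖ + ‖d‖ := by simpa using norm_add_le (v - d) d
    nlinarith [norm_nonneg v, norm_nonneg (v - d), norm_nonneg d, sq_nonneg (‖v - d‖ - ‖d‖)]
  -- The quadratic loses at least this much from d to v, and only the two errors can make up for it.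
  -- Bounding ‖v‖² by `h3` and absorbing 2η ‖v - d‖² ≤ (c/4) ‖v - d‖² leaves (c/4) ‖v - d‖² ≤ 3η
  -- ‖d‖².
  have h5 : c / 2 * ‖v - d‖ ^ 2 ≤ η * ‖v‖ ^ 2 + η * ‖d‖ ^ 2 := by linarith
  have h6 : η * ‖v‖ ^ 2 ≤ η * (2 * ‖v - d‖ ^ 2 + 2 * ‖d‖ ^ 2) := by gcongr
  have h7 : η * ‖v - d‖ ^ 2 ≤ c / 8 * ‖v - d‖ ^ 2 := by gcongr
  rw [div_mul_eq_mul_div, le_div_iff₀ hc]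
  nlinarith

/-- Nonnegativity at v - t G v reads ⟨v, T v⟩ - 2t ‖v‖² + t² ⟨G v, v⟩ ≥ 0, and t = 1 / (‖G‖ + 1)
makes the last term at most t ‖v‖². -/
theorem exists_coercive_of_rightInverse {T G : E →L[ℝ] E}
    (hT : ∀ v w, inner ℝ (T v) w = inner ℝ v (T w)) (h0 : ∀ v, 0 ≤ inner ℝ v (T v))
    (hTG : ∀ v, T (G v) = v) : ∃ c > 0, ∀ v, c * ‖v‖ ^ 2 ≤ inner ℝ v (T v) := by
  have hpos : 0 < ‖G‖ + 1 := by positivity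
  refine ⟨(‖G‖ + 1)⁻¹, by positivity, fun v => ?_⟩
  set t := (‖G‖ + 1)⁻¹ with ht
  have ht0 : 0 < t := by positivity
  have h1 := h0 (v - t • G v)
  have h2 : inner ℝ (G v) (T v) = ‖v‖ ^ 2 := by
    rw [← hT, hTG, real_inner_self_eq_norm_sq]
  have h3 : inner ℝ (G v) v ≤ ‖G‖ * ‖v‖ ^ 2 := by
    calc _ ≤ ‖G v‖ * ‖v‖ := real_inner_le_norm _ _
      _ ≤ (‖G‖ * ‖v‖) * ‖v‖ := by gcongr; exact G.le_opNorm v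
      _ = _ := by ring
  simp only [map_sub, map_smul, inner_sub_left, inner_sub_right, inner_smul_left, inner_smul_right,
    hTG, h2, real_inner_self_eq_norm_sq, conj_trivial] at h1
  have h4 : t * (t * inner ℝ (G v) v) ≤ t * ‖v‖ ^ 2 := by
    have h5 : t * ‖G‖ ≤ 1 := by
      rw [ht, inv_mul_le_iff₀ hpos]
      linarith
    have h6 : t * inner ℝ (G v) v ≤ t * (‖G‖ * ‖v‖ ^ 2) := by gcongr
    have h7 : t * (‖G‖ * ‖v‖ ^ 2) ≤ ‖v‖ ^ 2 := by
      rw [← mul_assoc]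
      exact mul_le_of_le_one_left (by positivity) h5
    exact mul_le_mul_of_nonneg_left (h6.trans h7) ht0.le
  linarith

end Argmax

/-! ### Convergence in probability and of means -/

section Convergence

variable {Ω : Type*} [MeasurableSpace Ω] {P : Measure Ω}

/-- Bounded means make Y tight: |Z| ≥ ε together with |Z| ≤ κ Y forces Y ≥ ε / κ, which by Markov's
inequality is rare uniformly in m once κ is small. -/
theorem tendstoInMeasure_zero_of_le_mul {Y Z : ℕ → Ω → ℝ} {T : ℝ} (hY : ∀ m, Integrable (Y m) P)
    (h0 : ∀ m ω, 0 ≤ Y m ω) (hT : ∀ m, ∫ ω, Y m ω ∂P ≤ T)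
    (h : ∀ ε > 0, WithHighProb P fun m ω => |Z m ω| ≤ ε * Y m ω) :
    TendstoInMeasure P Z atTop fun _ => 0 := by
  rw [tendstoInMeasure_iff_norm]
  intro ε hε
  have hT0 : 0 ≤ T := (integral_nonneg (h0 0)).trans (hT 0)
  refine ENNReal.tendsto_nhds_zero.2 fun γ hγ => ?_
  rcases eq_or_ne γ ∞ with rfl | hγt
  · exact Eventually.of_forall fun _ => le_top
  set g := γ.toReal with hg
  have hg0 : 0 < g := ENNReal.toReal_pos hγ.ne' hγt
  set κ := ε * g / (2 * (T + 1)) with hκ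
  have hκ0 : 0 < κ := by positivity
  have hev := ENNReal.tendsto_nhds_zero.1 (h κ hκ0) (ENNReal.ofReal (g / 2))
    (ENNReal.ofReal_pos.2 (by positivity))
  filter_upwards [hev] with m hm
  have hmk : P {ω | ε / κ ≤ Y m ω} ≤ ENNReal.ofReal (g / 2) := by
    refine (WithHighProb.measure_ge_le (hY m) (h0 m) (by positivity)).trans
      (ENNReal.ofReal_le_ofReal ?_)
    rw [div_le_iff₀ (by positivity)]
    have : g / 2 * (ε / κ) = T + 1 := by
      rw [hκ]
      field_simp
    rw [this]
    linarith [hT m]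
  calc P {ω | ε ≤ ‖Z m ω - 0‖}
      ≤ P ({ω | ¬ |Z m ω| ≤ κ * Y m ω} ∪ {ω | ε / κ ≤ Y m ω}) := by
        refine measure_mono fun ω hω => ?_
        by_cases hc : |Z m ω| ≤ κ * Y m ω
        · right
          simp only [Set.mem_ofPred_eq, sub_zero, Real.norm_eq_abs] at hω ⊢
          rw [div_le_iff₀ hκ0, mul_comm]
          exact hω.trans hc
        · exact Or.inl hc
    _ ≤ ENNReal.ofReal (g / 2) + ENNReal.ofReal (g / 2) :=
        (measure_union_le _ _).trans (add_le_add hm hmk)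
    _ = γ := by
        rw [← ENNReal.ofReal_add (by positivity) (by positivity), add_halves, hg,
          ENNReal.ofReal_toReal hγt]

/-- Truncation of a real number at levels `± M`. -/
def truncate (M y : ℝ) : ℝ := max (-M) (min y M)

theorem continuous_truncate (M : ℝ) : Continuous (truncate M) := by
  unfold truncate
  fun_prop

theorem abs_truncate_le {M : ℝ} (hM : 0 ≤ M) (y : ℝ) : |truncate M y| ≤ M := by
  rw [truncate, abs_le]
  exact ⟨le_max_left _ _, max_le (by linarith) (min_le_right _ _)⟩

theorem abs_sub_truncate_le {M : ℝ} (hM : 0 ≤ M) (y : ℝ) :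
    |y - truncate M y| ≤ if M ≤ |y| then |y| else 0 := by
  rw [truncate]
  split_ifs with h
  · rcases le_total 0 y with hy | hy
    · rw [abs_of_nonneg hy] at h ⊢
      rw [min_eq_right h, max_eq_right (by linarith), abs_of_nonneg (by linarith)]
      linarith
    · rw [abs_of_nonpos hy] at h ⊢
      rw [min_eq_left (by linarith), max_eq_left (by linarith), abs_of_nonpos (by linarith)]
      linarith
  · have h' := abs_lt.1 (not_le.1 h)
    rw [min_eq_left h'.2.le, max_eq_right h'.1.le]
    simp

/-- Convergence in distribution of a uniformly integrable sequence implies convergence of means. -/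
theorem tendsto_integral_of_uniformIntegrable [IsProbabilityMeasure P] {Y : ℕ → Ω → ℝ}
    {Q : Measure ℝ} [IsProbabilityMeasure Q]
    (hd : TendstoInDistribution Y atTop (fun t : ℝ => t) (fun _ => P) Q)
    (hQ : Integrable (fun t : ℝ => t) Q) (hui : UniformIntegrable Y 1 P) :
    Tendsto (fun m => ∫ ω, Y m ω ∂P) atTop (𝓝 (∫ t, t ∂Q)) := by
  rw [Metric.tendsto_atTop]
  intro ε hε
  obtain ⟨C, hC⟩ := hui.spec one_ne_zero ENNReal.one_ne_top (show 0 < ε / 4 by positivity)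
  have hQlim : Tendsto (fun n : ℕ => ∫ t, truncate n t ∂Q) atTop (𝓝 (∫ t, t ∂Q)) := by
    refine tendsto_integral_of_dominated_convergence (fun t => 2 * |t|)
      (fun n => (continuous_truncate n).aestronglyMeasurable) (hQ.abs.const_mul 2)
      (fun n => Eventually.of_forall fun t => ?_) (Eventually.of_forall fun t => ?_)
    · have h1 := abs_sub_truncate_le (M := n) n.cast_nonneg t
      have h2 : |t - truncate n t| ≤ |t| := h1.trans (by split_ifs <;> simp)
      have h3 := abs_sub_abs_le_abs_sub (truncate n t) t
      rw [abs_sub_comm] at h3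
      rw [Real.norm_eq_abs]
      linarith
    · refine tendsto_const_nhds.congr' ?_
      obtain ⟨n₀, hn₀⟩ := exists_nat_gt |t|
      filter_upwards [eventually_ge_atTop n₀] with n hn
      have h1 := abs_sub_truncate_le (M := n) n.cast_nonneg t
      have h2 : |t| < n := hn₀.trans_le (by exact_mod_cast hn)
      rw [if_neg (not_le.2 h2)] at h1
      linarith [abs_nonpos_iff.1 h1]
  -- One truncation level for everything: it costs at most ε/4 for Q and, since n ≥ C, at most ε/4
  -- for all Y m. Convergence in distribution handles the bounded continuous truncation, with
  -- another ε/4.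
  obtain ⟨n, hn, hnC⟩ := ((hQlim.eventually (Metric.ball_mem_nhds _
    (show 0 < ε / 4 by positivity))).and (eventually_ge_atTop ⌈(C : ℝ)⌉₊)).exists
  have hCn : (C : ℝ) ≤ n := (Nat.le_ceil _).trans (by exact_mod_cast hnC)
  have hbd : Tendsto (fun m => ∫ ω, truncate n (Y m ω) ∂P) atTop (𝓝 (∫ t, truncate n t ∂Q)) := by
    have h1 := ProbabilityMeasure.tendsto_iff_forall_integral_tendsto.1 hd.tendsto
      (BoundedContinuousFunction.ofNormedAddCommGroup (truncate n) (continuous_truncate n) n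
        fun t => abs_truncate_le n.cast_nonneg t)
    simp only [ProbabilityMeasure.coe_mk, BoundedContinuousFunction.coe_ofNormedAddCommGroup] at h1
    rw [Measure.map_id'] at h1
    refine h1.congr fun m => ?_
    rw [integral_map (hd.forall_aemeasurable m) (continuous_truncate n).aestronglyMeasurable]
  have hYint : ∀ m, Integrable (Y m) P := fun m => memLp_one_iff_integrable.1 (hui.memLp m)
  have hTint : ∀ m, Integrable (fun ω => truncate n (Y m ω)) P := fun m =>
    Integrable.of_bound ((continuous_truncate n).comp_aestronglyMeasurable
      (hYint m).aestronglyMeasurable) n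
      (Eventually.of_forall fun ω => abs_truncate_le n.cast_nonneg _)
  have hclose : ∀ m, |∫ ω, Y m ω ∂P - ∫ ω, truncate n (Y m ω) ∂P| ≤ ε / 4 := fun m => by
    rw [← integral_sub (hYint m) (hTint m)]
    have h1 : ‖∫ ω, (Y m ω - truncate n (Y m ω)) ∂P‖ₑ ≤ ENNReal.ofReal (ε / 4) := by
      refine (enorm_integral_le_lintegral_enorm _).trans (le_trans ?_ (hC m))
      rw [eLpNorm_one_eq_lintegral_enorm]
      refine lintegral_mono fun ω => ?_
      rw [enorm_le_iff_norm_le, Real.norm_eq_abs]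
      refine (abs_sub_truncate_le n.cast_nonneg (Y m ω)).trans ?_
      split_ifs with h
      · rw [Set.indicator_of_mem]
        · rfl
        · rw [Set.mem_ofPred_eq, ← NNReal.coe_le_coe]
          exact hCn.trans h
      · exact norm_nonneg _
    rwa [← ofReal_norm, ENNReal.ofReal_le_ofReal_iff (by positivity), Real.norm_eq_abs] at h1
  obtain ⟨m₀, hm₀⟩ := Metric.tendsto_atTop.1 hbd (ε / 4) (by positivity)
  refine ⟨m₀, fun m hm => ?_⟩
  have h1 := hm₀ m hm
  have h2 := hclose m
  rw [Real.dist_eq] at h1 hn ⊢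
  rw [abs_lt] at h1 hn ⊢
  rw [abs_le] at h2
  constructor <;> linarith

end Convergence

/-! ### The score form and the information operators -/

section Forms

variable {S : Type*} [MeasurableSpace S] {F : Measure S}

/-- The bilinear form induced by a bounded kernel on the linear span of the scores. -/
theorem exists_scoreForm {E : Type*} [NormedAddCommGroup E] [InnerProductSpace ℝ E] [SFinite F]
    {k : S → S → ℝ} {C : ℝ} (hk : Measurable (Function.uncurry k)) (hC : ∀ s t, |k s t| ≤ C)
    (hC0 : 0 ≤ C) {u : S → E} (hu : Integrable u F) :
    ∃ a : E →L[ℝ] E →L[ℝ] ℝ, ∀ v w,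
      a v w = kernelForm F k (fun x => inner ℝ (u x) v) fun x => inner ℝ (u x) w := by
  have hi : ∀ v, Integrable (fun x => inner ℝ (u x) v) F := fun v => hu.inner_const v
  have hle : ∀ v, ∫ x, |inner ℝ (u x) v| ∂F ≤ (∫ x, ‖u x‖ ∂F) * ‖v‖ := fun v => by
    rw [← integral_mul_const]
    exact integral_mono (hi v).abs (hu.norm.mul_const _) fun x => abs_real_inner_le_norm _ _
  let B : E →ₗ[ℝ] E →ₗ[ℝ] ℝ := LinearMap.mk₂ ℝ
    (fun v w => kernelForm F k (fun x => inner ℝ (u x) v) fun x => inner ℝ (u x) w)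
    (fun v v' w => by
      simp only [inner_add_right]
      exact kernelForm_add_left hk hC (hi v) (hi v') (hi w))
    (fun c v w => by
      simp only [inner_smul_right]
      exact kernelForm_smul_left c _ _)
    (fun v w w' => by
      simp only [inner_add_right]
      exact kernelForm_add_right hk hC (hi v) (hi w) (hi w'))
    (fun c v w => by
      simp only [inner_smul_right]
      exact kernelForm_smul_right c _ _)
  refine ⟨B.mkContinuous₂ (C * ((∫ x, ‖u x‖ ∂F) * ∫ x, ‖u x‖ ∂F)) fun v w => ?_, fun v w => rfl⟩
  refine (abs_kernelForm_le hC (hi v) (hi w)).trans ?_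
  have h0 : 0 ≤ ∫ x, |inner ℝ (u x) w| ∂F := integral_nonneg fun x => abs_nonneg _
  have h1 : 0 ≤ ∫ x, ‖u x‖ ∂F := integral_nonneg fun x => norm_nonneg _
  calc _ ≤ C * (((∫ x, ‖u x‖ ∂F) * ‖v‖) * ((∫ x, ‖u x‖ ∂F) * ‖w‖)) := by
        gcongr
        · exact hle v
        · exact hle w
    _ = _ := by ring

/-- T and G are the operators of J and J⁻¹. J⁻¹ is recorded on either side of the inner product
because V uses both P(x, z) and P(w, y). -/
theorem exists_infoOperators {p : ℕ} {u : S → EuclideanSpace ℝ (Fin p)} (hu : MemLp u 2 F)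
    (hdet : IsUnit (momentMatrix F u).det) :
    ∃ T G : EuclideanSpace ℝ (Fin p) →L[ℝ] EuclideanSpace ℝ (Fin p),
      (∀ v, T (G v) = v) ∧ (∀ v w, inner ℝ (T v) w = inner ℝ v (T w)) ∧
      (∀ v w, inner ℝ v (T w) = ∫ x, inner ℝ (u x) v * inner ℝ (u x) w ∂F) ∧
      ∀ v w, v.ofLp ⬝ᵥ ((momentMatrix F u)⁻¹ *ᵥ w.ofLp) = inner ℝ (G v) w ∧
        v.ofLp ⬝ᵥ ((momentMatrix F u)⁻¹ *ᵥ w.ofLp) = inner ℝ v (G w) := by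
  have hsymm : ∀ A : Matrix (Fin p) (Fin p) ℝ, Aᵀ = A → ∀ v w,
      inner ℝ (Matrix.toEuclideanCLM (𝕜 := ℝ) A v) w
        = inner ℝ v (Matrix.toEuclideanCLM (𝕜 := ℝ) A w) := fun A hA v w => by
    rw [real_inner_comm, Matrix.inner_toEuclideanCLM, Matrix.inner_toEuclideanCLM,
      Matrix.dotProduct_mulVec, ← Matrix.mulVec_transpose, hA, dotProduct_comm]
  refine ⟨Matrix.toEuclideanCLM (𝕜 := ℝ) (momentMatrix F u),
    Matrix.toEuclideanCLM (𝕜 := ℝ) (momentMatrix F u)⁻¹, fun v => ?_,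
    hsymm _ (momentMatrix_isSymm F u), fun v w => ?_, fun v w => ?_⟩
  · rw [← mul_apply_eq_comp, ← map_mul, Matrix.mul_nonsing_inv _ hdet, map_one]
    rfl
  · rw [Matrix.inner_toEuclideanCLM, dotProduct_momentMatrix hu]
  · have h1 := Matrix.inner_toEuclideanCLM (momentMatrix F u)⁻¹ v w
    refine ⟨?_, h1.symm⟩
    rw [hsymm _ _, h1]
    rw [Matrix.transpose_nonsing_inv, momentMatrix_isSymm]

end Forms

/-! ### The discrepancy at the estimator and its limit law -/

section Expansion

variable {S : Type*} [MeasurableSpace S] {Ω : Type*} [MeasurableSpace Ω] {P : Measure Ω}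
  {F : Measure S} {X : ℕ → Ω → S} {p : ℕ}

theorem IsPairwiseSample.memLp_clm_mean (hX : IsPairwiseSample P F X)
    {u : S → EuclideanSpace ℝ (Fin p)} (hu : MemLp u 2 F)
    (G : EuclideanSpace ℝ (Fin p) →L[ℝ] EuclideanSpace ℝ (Fin p)) (m : ℕ) :
    MemLp (fun ω => G ((m : ℝ)⁻¹ • ∑ i ∈ Finset.range m, u (X i ω))) 2 P :=
  G.comp_memLp' ((hX.memLp_sum hu m).const_smul (m : ℝ)⁻¹)

variable [IsProbabilityMeasure P]

theorem IsPairwiseSample.mul_integral_sq_norm_clm_mean (hX : IsPairwiseSample P F X)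
    {u : S → EuclideanSpace ℝ (Fin p)} (hu : MemLp u 2 F) (h0 : ∀ i, ∫ x, u x i ∂F = 0)
    (G : EuclideanSpace ℝ (Fin p) →L[ℝ] EuclideanSpace ℝ (Fin p)) (m : ℕ) (hm : m ≠ 0) :
    m * ∫ ω, ‖G ((m : ℝ)⁻¹ • ∑ i ∈ Finset.range m, u (X i ω))‖ ^ 2 ∂P
      = ∫ x, ‖G (u x)‖ ^ 2 ∂F := by
  have h1 := hX.integral_bilin_sum hu h0 ((innerSL ℝ).bilinearComp G G) m
  simp only [ContinuousLinearMap.bilinearComp_apply, innerSL_apply_apply,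
    real_inner_self_eq_norm_sq] at h1
  have hm' : (m : ℝ) ≠ 0 := by exact_mod_cast hm
  simp only [map_smul, norm_smul, mul_pow]
  rw [integral_const_mul, h1]
  simp only [norm_inv, Real.norm_natCast]
  field_simp

/-- Expansion of a smooth discrepancy at an approximate maximizer of the likelihood. -/
theorem LikelihoodExpansion.withHighProb_discrepancy [IsProbabilityMeasure F]
    {θ₀ : EuclideanSpace ℝ (Fin p)} {L : EuclideanSpace ℝ (Fin p) → S → ℝ}
    {u : S → EuclideanSpace ℝ (Fin p)}
    {W : S → EuclideanSpace ℝ (Fin p) →L[ℝ] EuclideanSpace ℝ (Fin p) →L[ℝ] ℝ} {ρ : ℝ}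
    {h H : S → ℝ} (hE : LikelihoodExpansion F θ₀ L u W ρ h H) (hX : IsPairwiseSample P F X)
    {T G : EuclideanSpace ℝ (Fin p) →L[ℝ] EuclideanSpace ℝ (Fin p)} (hTG : ∀ v, T (G v) = v)
    (hT : ∀ v w, inner ℝ (T v) w = inner ℝ v (T w))
    (hTF : ∀ v w, inner ℝ v (T w) = ∫ x, inner ℝ (u x) v * inner ℝ (u x) w ∂F)
    (h0 : ∀ i, ∫ x, u x i ∂F = 0)
    {a : EuclideanSpace ℝ (Fin p) →L[ℝ] EuclideanSpace ℝ (Fin p) →L[ℝ] ℝ}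
    {D : EuclideanSpace ℝ (Fin p) → ℝ}
    (hD : (fun θ => D θ - a (θ - θ₀) (θ - θ₀)) =o[𝓝 θ₀] fun θ => ‖θ - θ₀‖ ^ 2)
    {t : ℕ → Ω → EuclideanSpace ℝ (Fin p)}
    (hcons : ∀ ε > 0, WithHighProb P fun m ω => dist (t m ω) θ₀ < ε)
    (hmax : WithHighProb P fun m ω => ∀ θ ∈ Metric.ball θ₀ ρ,
      t m ω ∈ Metric.ball θ₀ ρ → ∑ i ∈ Finset.range m, Real.log (L θ (X i ω))
        ≤ ∑ i ∈ Finset.range m, Real.log (L (t m ω) (X i ω))) {ε : ℝ} (hε : 0 < ε) :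
    WithHighProb P fun m ω =>
      |D (t m ω) - a (G ((m : ℝ)⁻¹ • ∑ i ∈ Finset.range m, u (X i ω)))
        (G ((m : ℝ)⁻¹ • ∑ i ∈ Finset.range m, u (X i ω)))|
      ≤ ε * ‖G ((m : ℝ)⁻¹ • ∑ i ∈ Finset.range m, u (X i ω))‖ ^ 2 := by
  obtain ⟨c, hc, hcT⟩ := exists_coercive_of_rightInverse hT
    (fun v => by rw [hTF]; exact integral_nonneg fun x => mul_self_nonneg _) hTG
  have hA : 0 ≤ ‖a‖ := norm_nonneg a
  -- κ is the relative error in ‖v - d‖ ≤ κ ‖d‖. Then ‖v‖ ≤ 2 ‖d‖, and passing from a v v to a d d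
  -- costs at most 3 ‖a‖ κ ‖d‖² ≤ (ε/2) ‖d‖².
  set κ := min 1 (ε / (6 * (‖a‖ + 1))) with hκ
  have hκ0 : 0 < κ := lt_min one_pos (by positivity)
  have hκ1 : κ ≤ 1 := min_le_left _ _
  have hκa : 3 * ‖a‖ * κ ≤ ε / 2 := by
    have h1 : κ ≤ ε / (6 * (‖a‖ + 1)) := min_le_right _ _
    rw [le_div_iff₀ (by positivity)] at h1
    nlinarith
  -- Makes the factor 12 η / c of `norm_sub_sq_le_of_approx_quadratic` equal to κ².
  set η := c * κ ^ 2 / 12 with hη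
  have hη0 : 0 < η := by positivity
  have hη8 : η ≤ c / 8 := by
    have : κ ^ 2 ≤ 1 := pow_le_one₀ hκ0.le hκ1
    rw [hη]
    nlinarith
  obtain ⟨r, hr, hrρ, hlik⟩ := hE.withHighProb_loglik hX hη0
  obtain ⟨r₂, hr₂, hDr⟩ := Metric.eventually_nhds_iff.1
    (hD.def (show 0 < ε / 8 by positivity))
  -- The competitor θ₀ + d must lie in the ball where the expansion of the likelihood holds.
  have hsmall : WithHighProb P fun m ω =>
      ‖G ((m : ℝ)⁻¹ • ∑ i ∈ Finset.range m, u (X i ω))‖ ^ 2 < r ^ 2 := by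
    refine WithHighProb.of_integral_tendsto
      (fun m => (hX.memLp_clm_mean hE.memLp G m).integrable_norm_pow two_ne_zero)
      (fun m ω => by positivity) ?_ (by positivity)
    have h1 : Tendsto (fun m : ℕ => (∫ x, ‖G (u x)‖ ^ 2 ∂F) / m) atTop (𝓝 0) :=
      tendsto_const_div_atTop_nhds_zero_nat _
    refine h1.congr' ?_
    filter_upwards [eventually_ne_atTop 0] with m hm
    rw [← hX.mul_integral_sq_norm_clm_mean hE.memLp h0 G m hm]
    have hm' : (m : ℝ) ≠ 0 := by exact_mod_cast hm
    field_simp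
  refine ((((hcons (min r r₂) (lt_min hr hr₂)).and hsmall).and hlik).and hmax).mono
    ((eventually_gt_atTop 0).mono ?_)
  rintro m hm ω ⟨⟨⟨h1, h2⟩, h3⟩, h4⟩
  have hm0 : (0 : ℝ) < m := by exact_mod_cast hm
  set ub := (m : ℝ)⁻¹ • ∑ i ∈ Finset.range m, u (X i ω) with hub
  set d := G ub with hd
  set v := t m ω - θ₀ with hv
  have hTd : T d = ub := hTG ub
  have hdr : ‖d‖ < r := lt_of_pow_lt_pow_left₀ 2 hr.le h2
  have hdmem : θ₀ + d ∈ Metric.ball θ₀ r := by simpa using hdr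
  have htmem : t m ω ∈ Metric.ball θ₀ r := h1.trans_le (min_le_left _ _)
  have hsq : ∀ w, ∫ x, inner ℝ (u x) w ^ 2 ∂F = inner ℝ w (T w) := fun w => by
    rw [hTF]
    simp only [sq]
  have hbd := h3 _ hdmem
  have hbv := h3 _ htmem
  rw [hsq, ← hTd, add_sub_cancel_left] at hbd
  rw [hsq, ← hTd] at hbv
  have hle := h4 _ (Metric.ball_subset_ball hrρ hdmem) (Metric.ball_subset_ball hrρ htmem)
  have hvt : θ₀ + v = t m ω := add_sub_cancel _ _
  have key := norm_sub_sq_le_of_approx_quadratic hT hc hcT hη0.le hη8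
    (ℓ := fun w => (∑ i ∈ Finset.range m, Real.log (L (θ₀ + w) (X i ω))) / m)
    (d := d) (v := v) hbd (by rw [hvt]; exact hbv) (by
      simp only [hvt]
      gcongr)
  have hκd : ‖v - d‖ ≤ κ * ‖d‖ := by
    refine le_of_sq_le_sq ?_ (by positivity)
    refine key.trans_eq ?_
    rw [hη]
    field_simp
  have hv2 : ‖v‖ ≤ 2 * ‖d‖ := by
    have h5 : ‖v‖ ≤ ‖v - d‖ + ‖d‖ := by simpa using norm_add_le (v - d) d
    nlinarith [norm_nonneg d]
  have hDt := hDr (h1.trans_le (min_le_right _ _))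
  rw [Real.norm_eq_abs, Real.norm_of_nonneg (by positivity), ← hv] at hDt
  have hsplit : D (t m ω) - a d d
      = (D (t m ω) - a v v) + (a (v - d) v + a d (v - d)) := by
    simp only [map_sub, sub_apply]
    ring
  have b1 : |a (v - d) v| ≤ ‖a‖ * (κ * ‖d‖) * (2 * ‖d‖) :=
    (a.le_opNorm₂ _ _).trans (by gcongr)
  have b2 : |a d (v - d)| ≤ ‖a‖ * ‖d‖ * (κ * ‖d‖) :=
    (a.le_opNorm₂ _ _).trans (by gcongr)
  have b3 : ‖v‖ ^ 2 ≤ 4 * ‖d‖ ^ 2 := by nlinarith [norm_nonneg v, norm_nonneg d]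
  have b4 : 3 * ‖a‖ * κ * ‖d‖ ^ 2 ≤ ε / 2 * ‖d‖ ^ 2 := by gcongr
  rw [hsplit]
  calc _ ≤ |D (t m ω) - a v v| + (|a (v - d) v| + |a d (v - d)|) :=
        (abs_add_le _ _).trans (by gcongr; exact abs_add_le _ _)
    _ ≤ ε / 8 * (4 * ‖d‖ ^ 2) + (‖a‖ * (κ * ‖d‖) * (2 * ‖d‖) + ‖a‖ * ‖d‖ * (κ * ‖d‖)) := by
        gcongr
        exact hDt.trans (by gcongr)
    _ ≤ _ := by linarith

/-- Convergence in distribution of a quadratic form in normalized sums. -/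
theorem tendstoInDistribution_bilin (hX : ∀ i, Measurable (X i))
    (hlaw : ∀ i, P.map (X i) = F) (hindep : iIndepFun X P)
    {u : S → EuclideanSpace ℝ (Fin p)} (hu : MemLp u 2 F)
    (h0 : ∀ v, ∫ x, inner ℝ (u x) v ∂F = 0)
    (b : EuclideanSpace ℝ (Fin p) →L[ℝ] EuclideanSpace ℝ (Fin p) →L[ℝ] ℝ) :
    ∃ (Q : Measure ℝ) (_ : IsProbabilityMeasure Q),
      TendstoInDistribution (fun (m : ℕ) ω => b ((√m)⁻¹ • ∑ i ∈ Finset.range m, u (X i ω))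
        ((√m)⁻¹ • ∑ i ∈ Finset.range m, u (X i ω))) atTop (fun t : ℝ => t) (fun _ => P) Q ∧
      Integrable (fun t : ℝ => t) Q ∧ ∫ t, t ∂Q = ∫ x, b (u x) (u x) ∂F := by
  have hb : Continuous fun x => b x x := by fun_prop
  obtain ⟨hint, hmean⟩ := integral_bilin_multivariateGaussian hu b
  have hclt := (tendstoInDistribution_multivariateGaussian hX hlaw hindep hu h0).continuous_comp hb
  have hprob : IsProbabilityMeasure
      ((multivariateGaussian 0 (momentMatrix F u)).map fun x => b x x) :=
    Measure.isProbabilityMeasure_map hb.aemeasurable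
  refine ⟨_, hprob, ⟨hclt.forall_aemeasurable, aemeasurable_id', ?_⟩,
    (integrable_map_measure aestronglyMeasurable_id hb.aemeasurable).2 hint,
    (integral_map hb.aemeasurable aestronglyMeasurable_id).trans hmean⟩
  convert! hclt.tendsto using 3
  exact congrArg 𝓝 (Subtype.ext Measure.map_id')

end Expansion

/-! ### Empirical forms and log likelihood ratios -/

section Sums

variable {S : Type*}

theorem empiricalForm_eq_bilin {E : Type*} [NormedAddCommGroup E] [NormedSpace ℝ E]
    (b : E →L[ℝ] E →L[ℝ] ℝ) (u : S → E) (X : ℕ → S) (m : ℕ) :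
    empiricalForm (fun x y => b (u x) (u y)) (fun i : Fin m => X i)
      = b (∑ i ∈ Finset.range m, u (X i)) (∑ i ∈ Finset.range m, u (X i)) / (m : ℝ) ^ 2 := by
  rw [empiricalForm, ← Fin.sum_univ_eq_sum_range (fun i => u (X i)) m]
  simp only [map_sum, sum_apply]
  rw [Finset.sum_comm]

theorem sum_log_ratio_le_of_isMLE {p : ℕ} {Θ : Set (EuclideanSpace ℝ (Fin p))}
    {f : EuclideanSpace ℝ (Fin p) → S → ℝ} {θ₀ : EuclideanSpace ℝ (Fin p)} {n : ℕ} {x : ℕ → S}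
    {t θ : EuclideanSpace ℝ (Fin p)}
    (ht : IsMLE Θ f (fun i : Fin n => x i) t) (hθ : θ ∈ Θ) (h₀ : ∀ i, 0 ≤ f θ₀ (x i))
    (hpos : ∀ i, 0 < f θ (x i) / f θ₀ (x i)) (hpos' : ∀ i, 0 < f t (x i) / f θ₀ (x i)) :
    ∑ i ∈ Finset.range n, Real.log (f θ (x i) / f θ₀ (x i))
      ≤ ∑ i ∈ Finset.range n, Real.log (f t (x i) / f θ₀ (x i)) := by
  rw [← Real.log_prod fun i _ => (hpos i).ne', ← Real.log_prod fun i _ => (hpos' i).ne']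
  refine Real.log_le_log (Finset.prod_pos fun i _ => hpos i) ?_
  rw [Finset.prod_div_distrib, Finset.prod_div_distrib]
  refine div_le_div_of_nonneg_right ?_ (Finset.prod_nonneg fun i _ => h₀ i)
  rw [← Fin.prod_univ_eq_prod_range (fun i => f θ (x i)) n,
    ← Fin.prod_univ_eq_prod_range (fun i => f t (x i)) n]
  exact ht.2 θ hθ

end Sums

/-! ### The projected kernel as a bilinear form -/

section Model

variable {S : Type*} [MeasurableSpace S] {p : ℕ}
  {lam : Measure S} {f : EuclideanSpace ℝ (Fin p) → S → ℝ}
  {θ₀ : EuclideanSpace ℝ (Fin p)}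

theorem quadDist_self (K : Measure S → S → S → ℝ) (F : Measure S) : quadDist K F F = 0 := by
  rw [quadDist, quadForm]
  ring

/-- P(x, z) = ⟨G u(x), u(z)⟩ and P(w, y) = ⟨u(w), G u(y)⟩, so the double integral is the score form
at G u(x) and G u(y). -/
theorem exists_projectedKernel_eq [IsProbabilityMeasure (model lam f θ₀)] {k : S → S → ℝ} {C : ℝ}
    (hk : Measurable (Function.uncurry k)) (hC : ∀ s t, |k s t| ≤ C)
    (hu : Integrable (score f θ₀) (model lam f θ₀))
    {a : EuclideanSpace ℝ (Fin p) →L[ℝ] EuclideanSpace ℝ (Fin p) →L[ℝ] ℝ}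
    (ha : ∀ v w, a v w = kernelForm (model lam f θ₀) k (fun x => inner ℝ (score f θ₀ x) v)
      fun x => inner ℝ (score f θ₀ x) w)
    {G : EuclideanSpace ℝ (Fin p) →L[ℝ] EuclideanSpace ℝ (Fin p)}
    (hG : ∀ v w, v.ofLp ⬝ᵥ ((fisherInfo lam f θ₀)⁻¹ *ᵥ w.ofLp) = inner ℝ (G v) w ∧
      v.ofLp ⬝ᵥ ((fisherInfo lam f θ₀)⁻¹ *ᵥ w.ofLp) = inner ℝ v (G w)) :
    projectedKernel lam f θ₀ k
      = fun x y => a.bilinearComp G G (score f θ₀ x) (score f θ₀ y) := by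
  funext x y
  rw [ContinuousLinearMap.bilinearComp_apply, ha,
    kernelForm_eq_iterated hk hC (hu.inner_const _) (hu.inner_const _), projectedKernel]
  congr with z
  congr with w
  rw [projKernel, projKernel, (hG _ _).1, (hG (score f θ₀ w) _).2, real_inner_comm]
  ring

end Model

end QuadRisk

/-! ### The proposition -/

open QuadRisk
theorem proposition1
    {S : Type*} [MeasurableSpace S] {Ω : Type*} [MeasurableSpace Ω]
    (P : Measure Ω) [IsProbabilityMeasure P]
    -- the parametric model, with parameter space `Θ` and densities `f θ`
    {p : ℕ} (lam : Measure S) [SigmaFinite lam]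
    (Θ : Set (EuclideanSpace ℝ (Fin p))) (f : EuclideanSpace ℝ (Fin p) → S → ℝ)
    (hf : IsDensityFamily lam Θ f)
    -- the true distribution lies in the model, at a regular, identified parameter
    (Fτ : Measure S) (θτ : EuclideanSpace ℝ (Fin p))
    (hF : Fτ = model lam f θτ)
    (hreg : CramerRegularAt lam Θ f θτ)
    (hsep : WaldSeparatedAt lam Θ f θτ)
    -- the kernel, possibly depending on the second argument of the distance
    (K : Measure S → S → S → ℝ)
    (hK : ∀ θ ∈ Θ, IsCNNDKernel (K (model lam f θ)))
    (hKbdd : ∃ C : ℝ, ∀ᶠ θ in 𝓝 θτ, ∀ s t, |K (model lam f θ) s t| ≤ C)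
    (hKcont : ∀ᵐ z ∂(Fτ.prod Fτ),
      Tendsto (fun θ => K (model lam f θ) z.1 z.2) (𝓝 θτ) (𝓝 (K Fτ z.1 z.2)))
    -- independent observations from `Fτ`
    (X : ℕ → Ω → S) (hX : ∀ i, Measurable (X i)) (hlaw : ∀ i, P.map (X i) = Fτ)
    (hindep : iIndepFun X P)
    -- the estimator: maximum likelihood, with probability tending to one
    (θhat : (m : ℕ) → (Fin m → S) → EuclideanSpace ℝ (Fin p))
    (hmle : Tendsto (fun m : ℕ => P {ω | ¬ IsMLE Θ f (fun i : Fin m => X i ω)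
      (θhat m (fun i : Fin m => X i ω))}) atTop (𝓝 0))
    -- the estimated distance is a random variable
    (hmeas : ∀ m : ℕ, AEMeasurable
      (fun ω => quadDist K Fτ (model lam f (θhat m (fun i : Fin m => X i ω)))) P) :
    quadDist K Fτ (model lam f θτ) = 0 ∧
    TendstoInMeasure P
      (fun (m : ℕ) ω =>
        (m : ℝ) * quadDist K Fτ (model lam f (θhat m (fun i : Fin m => X i ω)))
          - (m : ℝ) * empiricalForm (projectedKernel lam f θτ (K Fτ)) (fun i : Fin m => X i ω))
      atTop (fun _ => (0 : ℝ)) ∧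
    Integrable (fun x => projectedKernel lam f θτ (K Fτ) x x) Fτ ∧
    (∀ m : ℕ, 1 ≤ m →
      Integrable (fun ω => (m : ℝ) *
        empiricalForm (projectedKernel lam f θτ (K Fτ)) (fun i : Fin m => X i ω)) P ∧
      ∫ ω, (m : ℝ) *
        empiricalForm (projectedKernel lam f θτ (K Fτ)) (fun i : Fin m => X i ω) ∂P
        = kernelTrace Fτ (projectedKernel lam f θτ (K Fτ))) ∧
    HasAsymptoticMean P
      (fun (m : ℕ) ω =>
        (m : ℝ) * quadDist K Fτ (model lam f (θhat m (fun i : Fin m => X i ω))))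
      (kernelTrace Fτ (projectedKernel lam f θτ (K Fτ))) ∧
    (UniformIntegrable
      (fun (m : ℕ) ω =>
        (m : ℝ) * quadDist K Fτ (model lam f (θhat m (fun i : Fin m => X i ω)))) 1 P →
      Tendsto (fun m : ℕ => (m : ℝ) *
          ∫ ω, (quadDist K Fτ (model lam f (θhat m (fun i : Fin m => X i ω)))
            - quadDist K Fτ (model lam f θτ)) ∂P)
        atTop (𝓝 (kernelTrace Fτ (projectedKernel lam f θτ (K Fτ))))) := by
  subst hF
  obtain ⟨W, ρ, h, H, hE, hball, hmodel⟩ := hreg.exists_expansion hf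
  have hθτ : θτ ∈ Θ := hball (Metric.mem_ball_self hE.radius_pos)
  have hprob : IsProbabilityMeasure (model lam f θτ) := hf.isProbabilityMeasure θτ hθτ
  have hsamp := IsPairwiseSample.of_iIndepFun hX hlaw hindep
  have hk₀ := (hK θτ hθτ).measurable
  obtain ⟨C₀, hC₀⟩ := (hK θτ hθτ).bounded
  obtain ⟨C₁, hC₁⟩ := hKbdd
  -- A single nonnegative constant for the kernel at θτ and for those nearby.
  have hC : ∀ s t, |K (model lam f θτ) s t| ≤ max (max C₀ C₁) 0 := fun s t =>
    (hC₀ s t).trans ((le_max_left _ _).trans (le_max_left _ _))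
  have hu := hE.memLp
  have hui := hE.integrable_score
  obtain ⟨a, ha⟩ := exists_scoreForm hk₀ hC (le_max_right _ _) hui
  -- `fisherInfo` is by definition the `momentMatrix` of the score.
  obtain ⟨T, G, hTG, hT, hTF, hG⟩ := exists_infoOperators hu hreg.info_nonsingular
  set b := a.bilinearComp G G with hb
  have hV : projectedKernel lam f θτ (K (model lam f θτ))
      = fun x y => b (score f θτ x) (score f θτ y) := exists_projectedKernel_eq hk₀ hC hui ha hG
  have h0 : ∀ v, ∫ x, inner ℝ (score f θτ x) v ∂(model lam f θτ) = 0 := hE.integral_inner_score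
  have h0' : ∀ i, ∫ x, score f θτ x i ∂(model lam f θτ) = 0 := fun i => by
    simpa [EuclideanSpace.inner_single_right] using h0 (EuclideanSpace.single i 1)
  have hemp : ∀ (m : ℕ) ω, empiricalForm (projectedKernel lam f θτ (K (model lam f θτ)))
      (fun i : Fin m => X i ω) = b (∑ i ∈ Finset.range m, score f θτ (X i ω))
        (∑ i ∈ Finset.range m, score f θτ (X i ω)) / (m : ℝ) ^ 2 := fun m ω => by
    rw [hV]
    exact empiricalForm_eq_bilin b (score f θτ) (fun i => X i ω) m
  have htrace : kernelTrace (model lam f θτ) (projectedKernel lam f θτ (K (model lam f θτ)))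
      = ∫ x, b (score f θτ x) (score f θτ x) ∂(model lam f θτ) := by
    rw [hV]
    rfl
  have hD : (fun θ => quadDist K (model lam f θτ) (model lam f θ) - a (θ - θτ) (θ - θτ))
      =o[𝓝 θτ] fun θ => ‖θ - θτ‖ ^ 2 := by
    have hmem := Metric.ball_mem_nhds θτ hE.radius_pos
    refine (hE.quadForm_isLittleO (k := fun θ => K (model lam f θ)) ?_ hk₀ ?_ hC hKcont).congr' ?_
      EventuallyEq.rfl
    · filter_upwards [hmem] with θ hθ using (hK θ (hball hθ)).measurable
    · filter_upwards [hC₁] with θ hθ s t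
      exact (hθ s t).trans ((le_max_right _ _).trans (le_max_left _ _))
    · filter_upwards [hmem] with θ hθ
      rw [ha, ← hmodel θ hθ, quadDist]
  -- Restricted to the ball, where all ratios are positive and logarithms preserve the comparison of
  -- likelihoods.
  have hmax : WithHighProb P fun m ω => ∀ θ ∈ Metric.ball θτ ρ,
      θhat m (fun i : Fin m => X i ω) ∈ Metric.ball θτ ρ →
      ∑ i ∈ Finset.range m, Real.log (f θ (X i ω) / f θτ (X i ω)) ≤ ∑ i ∈ Finset.range m,
        Real.log (f (θhat m (fun i : Fin m => X i ω)) (X i ω) / f θτ (X i ω)) := by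
    refine (WithHighProb.and hmle (.of_ae fun _ => hsamp.ae_all hE.pos)).mono
      (Eventually.of_forall ?_)
    rintro m ω ⟨h1, h2⟩ θ hθ ht
    exact sum_log_ratio_le_of_isMLE (x := fun i => X i ω) h1 (hball hθ)
      (fun i => hf.nonneg θτ hθτ _) (fun i => h2 i θ hθ) fun i => h2 i _ ht
  have hexp : ∀ ε > 0, WithHighProb P fun m ω =>
      |quadDist K (model lam f θτ) (model lam f (θhat m (fun i : Fin m => X i ω)))
        - a (G ((m : ℝ)⁻¹ • ∑ i ∈ Finset.range m, score f θτ (X i ω)))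
          (G ((m : ℝ)⁻¹ • ∑ i ∈ Finset.range m, score f θτ (X i ω)))|
      ≤ ε * ‖G ((m : ℝ)⁻¹ • ∑ i ∈ Finset.range m, score f θτ (X i ω))‖ ^ 2 := fun ε hε =>
    hE.withHighProb_discrepancy hsamp hTG hT hTF h0' hD
      (t := fun m ω => θhat m (fun i : Fin m => X i ω))
      (fun ε hε => hsep.withHighProb_dist_lt hf hθτ hX hlaw hindep hmle hε) hmax hε
  have hprob_lim : TendstoInMeasure P
      (fun (m : ℕ) ω =>
        (m : ℝ) * quadDist K (model lam f θτ) (model lam f (θhat m (fun i : Fin m => X i ω)))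
          - (m : ℝ) * empiricalForm (projectedKernel lam f θτ (K (model lam f θτ)))
            (fun i : Fin m => X i ω)) atTop (fun _ => (0 : ℝ)) := by
    refine tendstoInMeasure_zero_of_le_mul
      (Y := fun (m : ℕ) ω => (m : ℝ) *
        ‖G ((m : ℝ)⁻¹ • ∑ i ∈ Finset.range m, score f θτ (X i ω))‖ ^ 2)
      (T := ∫ x, ‖G (score f θτ x)‖ ^ 2 ∂(model lam f θτ))
      (fun m => ((hsamp.memLp_clm_mean hu G m).integrable_norm_pow two_ne_zero).const_mul _)
      (fun m ω => by positivity) (fun m => ?_) fun ε hε => ?_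
    · rw [integral_const_mul]
      rcases eq_or_ne m 0 with rfl | hm
      · simpa using integral_nonneg fun x => by positivity
      · exact (hsamp.mul_integral_sq_norm_clm_mean hu h0' G m hm).le
    · refine (hexp ε hε).mono (Eventually.of_forall fun m ω hm => ?_)
      have h1 : empiricalForm (projectedKernel lam f θτ (K (model lam f θτ)))
          (fun i : Fin m => X i ω)
          = a (G ((m : ℝ)⁻¹ • ∑ i ∈ Finset.range m, score f θτ (X i ω)))
            (G ((m : ℝ)⁻¹ • ∑ i ∈ Finset.range m, score f θτ (X i ω))) := by
        rw [hemp, hb, ContinuousLinearMap.bilinearComp_apply]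
        simp only [map_smul, smul_apply, smul_eq_mul]
        ring
      rw [h1, ← mul_sub, abs_mul, Nat.abs_cast, mul_left_comm]
      gcongr
  have hmeas' : ∀ m : ℕ, AEMeasurable (fun ω => (m : ℝ) *
      quadDist K (model lam f θτ) (model lam f (θhat m (fun i : Fin m => X i ω)))) P :=
    fun m => (hmeas m).const_mul _
  obtain ⟨Q, hQ, hdist, hQint, hQmean⟩ := tendstoInDistribution_bilin hX hlaw hindep hu h0 b
  have hlim : TendstoInDistribution (fun (m : ℕ) ω => (m : ℝ) *
      quadDist K (model lam f θτ) (model lam f (θhat m (fun i : Fin m => X i ω)))) atTop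
      (fun t : ℝ => t) (fun _ => P) Q := by
    -- Slutsky: the scaled distance differs from the quadratic form in normalized scores by a term
    -- vanishing in probability.
    refine tendstoInDistribution_of_tendstoInMeasure_sub _ _ hdist ?_ hmeas'
    refine hprob_lim.congr_left fun m => Eventually.of_forall fun ω => ?_
    simp only [Pi.sub_apply, hemp, map_smul, smul_apply, smul_eq_mul]
    congr 1
    rcases eq_or_ne m 0 with rfl | hm
    · simp
    · have hm' : (0 : ℝ) < m := by positivity
      rw [← mul_assoc, ← mul_inv, Real.mul_self_sqrt hm'.le]
      field_simp
  refine ⟨quadDist_self K _, hprob_lim, ?_, fun m hm => ?_, ⟨Q, hQ, hlim, hQint, ?_⟩, fun hUI => ?_⟩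
  · rw [hV]
    exact integrable_bilin hu hu b
  · have hm' : (m : ℝ) ≠ 0 := by positivity
    simp only [hemp, htrace]
    refine ⟨((integrable_bilin (hsamp.memLp_sum hu m) (hsamp.memLp_sum hu m) b).div_const
      _).const_mul _, ?_⟩
    rw [integral_const_mul, integral_div, hsamp.integral_bilin_sum hu h0' b m]
    field_simp
  · rw [htrace, hQmean]
  · have h1 := tendsto_integral_of_uniformIntegrable hlim hQint hUI
    rw [hQmean, ← htrace] at h1
    refine h1.congr fun m => ?_
    rw [quadDist_self]
    simp only [sub_zero]
    rw [integral_const_mul]
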